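/- Let $T>0$, let $\Omega\subset\mathbb R$ be a nonempty, open, connected set, let $Y=(0,1)$, and let $\Sigma\subsetneq Y$ be a nonempty open set. For $0<\epsilon\le 1$ let $$\Omega_\epsilon=\Bigl(\bigcup_{j\in\mathbb Z}\epsilon(j+\Sigma)\Bigr)\cap\Omega,\qquad a_\epsilon=\epsilon^2\ \text{ in }\Omega_\epsilon,\qquad a_\epsilon=1\ \text{ in }\Omega\setminus\Omega_\epsilon .$$ Let $u^0,v^0\in H^1_0(\Omega)$, and for every $\epsilon\in(0,1]$ let $u_\epsilon\in L^2(0,T;H^1_0(\Omega))$, with $\partial_t u_\epsilon\in L^2(0,T;L^2(\Omega))$ and $\partial_{tt}u_\epsilon\in L^2(0,T;H^{-1}(\Omega))$, be the weak solution of the wave equation with right-hand side $f\equiv 0$: $$\langle\partial_{tt}u_\epsilon,v\rangle+\int_\Omega a_\epsilon\,\partial_xu_\epsilon\,\partial_x v\,dx=0\quad\text{for all }v\in H^1_0(\Omega)\text{ and a.e. }t\in[0,T],$$ with $u_\epsilon(\cdot,0)=u^0$ and $\partial_tu_\epsilon(\cdot,0)=v^0$ (in the sense of the continuous representatives with values in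 $L^2(\Omega)$ and $H^{-1}(\Omega)$, respectively). Then there is $\hat u\in L^2(0,T;H^1_0(\Omega))$ with $\partial_t\hat u\in L^2(0,T;L^2(\Omega))$ such that the whole family $u_\epsilon$ two-scale converges to $\hat u$ as $\epsilon\to0$. That is, $u_\epsilon$ is bounded in $L^2((0,T)\times\Omega)$ for all small $\epsilon$, and $$\lim_{\epsilon\to0}\int_0^T\!\!\int_\Omega u_\epsilon(x,t)\,\psi\bigl(t,x,\tfrac x\epsilon\bigr)\,dx\,dt=\int_0^T\!\!\int_\Omega\int_Y\hat u(x,t)\,\psi(t,x,y)\,dy\,dx\,dt$$ for every smooth function $\psi(t,x,y)$ that is $1$-periodic in $y$ and compactly supported in $(t,x)\in(0,T)\times\Omega$. Moreover, $\hat u$ is given explicitly by $$\hat u(x,t)=u^0(x)+v^0(x)\,t .$$ -/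

import Mathlib

open MeasureTheory Set Filter Topology
open scoped ENNReal NNReal ContDiff

noncomputable section

namespace HighContrastWave

/-- The Hilbert space `L²(Ω)` of an open set `Ω ⊆ ℝ`. -/
abbrev L2 (Ω : Set ℝ) : Type := Lp ℝ 2 (volume.restrict Ω)

/-- The unit cell `Y = (0,1)`. -/
abbrev unitCell : Set ℝ := Ioo 0 1

/-- Lebesgue measure on `Ω × Y`. -/
abbrev cellMeasure (Ω : Set ℝ) : Measure (ℝ × ℝ) :=
  (volume.restrict Ω).prod (volume.restrict unitCell)

/-- The Hilbert space `L²(Ω × Y)`. -/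
abbrev L2Cell (Ω : Set ℝ) : Type := Lp ℝ 2 (cellMeasure Ω)

/-- Lebesgue measure on the time interval `(0,T)`. -/
abbrev timeMeasure (T : ℝ) : Measure ℝ := volume.restrict (Ioo 0 T)

/-- `u` belongs to the Bochner space `L²(0,T;X)`. -/
def MemBochnerL2 {X : Type*} [NormedAddCommGroup X] (T : ℝ) (u : ℝ → X) : Prop :=
  MemLp u 2 (timeMeasure T)

/-- `φ ∈ C_c^∞(U)` for an open set `U ⊆ ℝ`. -/
structure IsTestFunction (U : Set ℝ) (φ : ℝ → ℝ) : Prop where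
  contDiff : ContDiff ℝ ∞ φ
  hasCompactSupport : HasCompactSupport φ
  tsupport_subset : tsupport φ ⊆ U

/-! ### The Sobolev space `H^1_0(Ω)` and its dual -/

/-- The pairs `(φ, φ')` in `L²(Ω) × L²(Ω)` with `φ ∈ C_c^∞(Ω)`. -/
def testGraph (Ω : Set ℝ) : Submodule ℝ (WithLp 2 (L2 Ω × L2 Ω)) where
  carrier := {p | ∃ φ : ℝ → ℝ, IsTestFunction Ω φ ∧
    p.fst =ᵐ[volume.restrict Ω] φ ∧ p.snd =ᵐ[volume.restrict Ω] deriv φ}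
  zero_mem' := by
    refine ⟨0, ⟨contDiff_const, HasCompactSupport.zero, by simp [tsupport]⟩, ?_, ?_⟩
    · exact Lp.coeFn_zero ℝ 2 _
    · have h : deriv (0 : ℝ → ℝ) = 0 := by ext x; simp
      rw [h]
      exact Lp.coeFn_zero ℝ 2 _
  add_mem' := by
    rintro p q ⟨φ, hφ, hp, hp'⟩ ⟨ψ, hψ, hq, hq'⟩
    refine ⟨φ + ψ, ⟨hφ.contDiff.add hψ.contDiff, hφ.hasCompactSupport.add hψ.hasCompactSupport,
      (tsupport_add φ ψ).trans (union_subset hφ.tsupport_subset hψ.tsupport_subset)⟩, ?_, ?_⟩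
    · exact (Lp.coeFn_add p.fst q.fst).trans (hp.add hq)
    · have h : deriv (φ + ψ) = deriv φ + deriv ψ := by
        ext x
        exact deriv_add (hφ.contDiff.differentiable (by simp) x)
          (hψ.contDiff.differentiable (by simp) x)
      rw [h]
      exact (Lp.coeFn_add p.snd q.snd).trans (hp'.add hq')
  smul_mem' := by
    rintro c p ⟨φ, hφ, hp, hp'⟩
    refine ⟨c • φ, ⟨contDiff_const.smul hφ.contDiff, hφ.hasCompactSupport.smul_left (f := fun _ => c),
      (closure_mono (Function.support_const_smul_subset c φ)).trans hφ.tsupport_subset⟩, ?_, ?_⟩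
    · exact (Lp.coeFn_smul c p.fst).trans (hp.const_smul c)
    · have h : deriv (c • φ) = c • deriv φ := by
        ext x
        exact deriv_const_smul c (hφ.contDiff.differentiable (by simp) x)
      rw [h]
      exact (Lp.coeFn_smul c p.snd).trans (hp'.const_smul c)

/-- The Sobolev space `H^1_0(Ω)`: the closure of `C_c^∞(Ω)` in the norm
`(‖v‖² + ‖v'‖²)^{1/2}` of `H^1(Ω)`. An element is stored as the pair `(v, v')` of the function and
its weak derivative in `L²(Ω) × L²(Ω)`. -/
def H10 (Ω : Set ℝ) : Type := (testGraph Ω).topologicalClosure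

instance (Ω : Set ℝ) : NormedAddCommGroup (H10 Ω) :=
  inferInstanceAs (NormedAddCommGroup (testGraph Ω).topologicalClosure)

instance (Ω : Set ℝ) : InnerProductSpace ℝ (H10 Ω) :=
  inferInstanceAs (InnerProductSpace ℝ (testGraph Ω).topologicalClosure)

instance (Ω : Set ℝ) : CompleteSpace (H10 Ω) :=
  inferInstanceAs (CompleteSpace (testGraph Ω).topologicalClosure)

/-- The map `v ↦ (v, v')` from `H^1_0(Ω)` to `L²(Ω) × L²(Ω)`. -/
def toPair (Ω : Set ℝ) : H10 Ω →L[ℝ] WithLp 2 (L2 Ω × L2 Ω) :=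
  (testGraph Ω).topologicalClosure.subtypeL

/-- The inclusion `H^1_0(Ω) → L²(Ω)`. -/
def toL2 (Ω : Set ℝ) : H10 Ω →L[ℝ] L2 Ω :=
  (WithLp.fstL 2 ℝ (L2 Ω) (L2 Ω)).comp (toPair Ω)

/-- The weak derivative `H^1_0(Ω) → L²(Ω)`, `v ↦ v'`. -/
def grad (Ω : Set ℝ) : H10 Ω →L[ℝ] L2 Ω :=
  (WithLp.sndL 2 ℝ (L2 Ω) (L2 Ω)).comp (toPair Ω)

/-- The space `H^{-1}(Ω)`, the dual of `H^1_0(Ω)`. -/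
abbrev HNeg1 (Ω : Set ℝ) : Type := H10 Ω →L[ℝ] ℝ

/-- The embedding `L²(Ω) → H^{-1}(Ω)`, `g ↦ (v ↦ (g, v)_{L²(Ω)})`. -/
def toHNeg1 {Ω : Set ℝ} (g : L2 Ω) : HNeg1 Ω :=
  (innerSL ℝ g).comp (toL2 Ω)

/-! ### Time derivatives and initial values of Bochner functions -/

/-- `u'` is the weak (distributional) time derivative of `u` on `(0,T)`, for functions with values
in a Banach space `X`. -/
def HasWeakTimeDeriv {X : Type*} [NormedAddCommGroup X] [NormedSpace ℝ X] (T : ℝ)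
    (u u' : ℝ → X) : Prop :=
  ∀ φ : ℝ → ℝ, IsTestFunction (Ioo 0 T) φ →
    ∫ t in Ioo 0 T, deriv φ t • u t = -∫ t in Ioo 0 T, φ t • u' t

/-- `u(0) = x₀` for a Bochner function `u` on `(0,T)`: the function `u` has a representative that
is continuous on `[0,T]` with values in `X`, and this representative takes the value `x₀` at `0`. -/
def HasInitialValue {X : Type*} [NormedAddCommGroup X] (T : ℝ) (u : ℝ → X) (x₀ : X) : Prop :=
  ∃ U : ℝ → X, ContinuousOn U (Icc 0 T) ∧ U =ᵐ[timeMeasure T] u ∧ U 0 = x₀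

/-! ### The wave equation -/

/-- The bilinear form `b(v,w) = ∫_Ω a v' w'`. -/
def bilin (Ω : Set ℝ) (a : ℝ → ℝ) (v w : H10 Ω) : ℝ :=
  ∫ x in Ω, a x * grad Ω v x * grad Ω w x

/-- `u` is a weak solution of `∂_tt u - (a u')' = f` in `Ω × (0,T]` with `u = 0` on the boundary
of `Ω`, `u(0) = u⁰` and `∂_t u(0) = v⁰`: one has `u ∈ L²(0,T;H^1_0(Ω))`,
`∂_t u ∈ L²(0,T;L²(Ω))`, `∂_tt u ∈ L²(0,T;H^{-1}(Ω))`, and for all `v ∈ H^1_0(Ω)`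
`⟨∂_tt u, v⟩ + b(u,v) = (f,v)` for almost every time. The initial value of `u` is taken in `L²(Ω)`,
that of `∂_t u` in `H^{-1}(Ω)`. -/
def IsWeakSolution (T : ℝ) (Ω : Set ℝ) (a : ℝ → ℝ) (f : ℝ → L2 Ω) (u₀ : H10 Ω) (v₀ : L2 Ω)
    (u : ℝ → H10 Ω) : Prop :=
  MemBochnerL2 T u ∧
  ∃ (u' : ℝ → L2 Ω) (u'' : ℝ → HNeg1 Ω),
    MemBochnerL2 T u' ∧
    MemBochnerL2 T u'' ∧
    HasWeakTimeDeriv T (fun t => toL2 Ω (u t)) u' ∧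
    HasWeakTimeDeriv T (fun t => toHNeg1 (u' t)) u'' ∧
    (∀ v : H10 Ω, ∀ᵐ t ∂timeMeasure T,
      u'' t v + bilin Ω a (u t) v = inner ℝ (f t) (toL2 Ω v)) ∧
    HasInitialValue T (fun t => toL2 Ω (u t)) (toL2 Ω u₀) ∧
    HasInitialValue T (fun t => toHNeg1 (u' t)) (toHNeg1 v₀)

/-- The periodic inclusions `Ω_ε = (⋃_{j ∈ ℤ} ε (j + S)) ∩ Ω`. -/
def inclusions (ε : ℝ) (S Ω : Set ℝ) : Set ℝ :=
  (⋃ j : ℤ, (fun y : ℝ => ε * ((j : ℝ) + y)) '' S) ∩ Ω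

open Classical in
/-- The coefficient with value `a₀` in `Ω_ε` and value `1` elsewhere. -/
def coeff (a₀ ε : ℝ) (S Ω : Set ℝ) (x : ℝ) : ℝ :=
  if x ∈ inclusions ε S Ω then a₀ else 1

/-! ### Two-scale convergence -/

/-- `ψ ∈ C_c^∞((0,T) × Ω; C^∞_#(Y))`: smooth functions `ψ(t,x,y)`, compactly supported in
`(t,x) ∈ (0,T) × Ω` and `1`-periodic in `y`. -/
structure IsTwoScaleTest (T : ℝ) (Ω : Set ℝ) (ψ : ℝ × ℝ × ℝ → ℝ) : Prop where
  contDiff : ContDiff ℝ ∞ ψ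
  periodic : ∀ t x y : ℝ, ψ (t, x, y + 1) = ψ (t, x, y)
  support : ∃ K : Set (ℝ × ℝ), IsCompact K ∧ K ⊆ Ioo 0 T ×ˢ Ω ∧
    ∀ t x y : ℝ, (t, x) ∉ K → ψ (t, x, y) = 0

/-- Two-scale convergence of `u_ε ∈ L²(0,T;L²(Ω)) = L²((0,T) × Ω)`, as `ε → 0` through the positive
reals, to `U ∈ L²(0,T;L²(Ω × Y)) = L²((0,T) × Ω × Y)`: the family is bounded for small `ε`, and
`∫_0^T ∫_Ω u_ε(t,x) ψ(t,x,x/ε) dx dt → ∫_0^T ∫_Ω ∫_Y U(t,x,y) ψ(t,x,y) dy dx dt` for all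
admissible `ψ`. -/
def TwoScaleConverges (T : ℝ) (Ω : Set ℝ) (u : ℝ → ℝ → L2 Ω) (U : ℝ → L2Cell Ω) : Prop :=
  (∃ C : ℝ≥0, ∀ᶠ ε in 𝓝[>] (0 : ℝ),
    MemBochnerL2 T (u ε) ∧ eLpNorm (u ε) 2 (timeMeasure T) ≤ C) ∧
  MemBochnerL2 T U ∧
  ∀ ψ : ℝ × ℝ × ℝ → ℝ, IsTwoScaleTest T Ω ψ →
    Tendsto (fun ε : ℝ => ∫ t in Ioo 0 T, ∫ x in Ω, u ε t x * ψ (t, x, x / ε))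
      (𝓝[>] (0 : ℝ))
      (𝓝 (∫ t in Ioo 0 T, ∫ p, U t p * ψ (t, p.1, p.2) ∂cellMeasure Ω))

instance : IsProbabilityMeasure (volume.restrict unitCell) :=
  ⟨by simp [unitCell]⟩

/-- A function of `x ∈ Ω`, regarded as a function of `(x,y) ∈ Ω × Y` that does not depend on
`y`. -/
def constInCell {Ω : Set ℝ} (g : L2 Ω) : L2Cell Ω :=
  Lp.compMeasurePreserving Prod.fst measurePreserving_fst g

end HighContrastWave

end

open HighContrastWave

/-! In one dimension the soft inclusions cut the stiff material into separate pieces, so no stress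
is transmitted in the limit: the equation degenerates to ∂_tt û = 0, whence û = u⁰ + t v⁰. The proof
gives more than two-scale convergence: z = u_ε - u⁰ - t v⁰ tends to 0 in L²(Ω), uniformly in time up
to null sets.

Weak solutions are too rough to be tested with ∂_t u, so the equation is integrated in time. With d
= ∂_t u - v⁰, U = ∫₀ᵗ u, P = ∫₀ᵗ U and b the energy form, one has (d, w) = -b(U, w) and z = ∫₀ᵗ d.
Testing with z gives an identity for ‖z‖² + b(U, U) whose right side contains only b(P, u⁰) and b(P,
v⁰) (`IntegratedWave.energy`). Cauchy–Schwarz for b bounds z uniformly in ε. For smallness, b(P, w)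
is estimated in two ways: it equals -(z, w), which is small if w is small in L², and it is at most a
constant times √b(w, w), which is small if w has small energy. It therefore suffices to write u⁰ and
v⁰ as sums of two such terms (`IntegratedWave.norm_primitive_le`).

The correctors for this splitting are φ(ε χ(x/ε)), where φ is a test function and χ a smooth
staircase rising only inside the copies of the inclusion. They differ from φ by O(ε), and their
derivative lives where the coefficient is ε², so their energy is O(ε²) (`exists_staircase`,
`eventually_exists_corrector`). Finally, strong convergence passes to the two-scale limit by the
mean value property of oscillating functions (`tendsto_integral_oscillating`). -/

noncomputable section

namespace HighContrastWave

/-! ### Primitives and weak time derivatives -/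

section Primitive

variable {X Y Z : Type*} [NormedAddCommGroup X] [NormedSpace ℝ X] [CompleteSpace X]
  [NormedAddCommGroup Y] [NormedSpace ℝ Y] [CompleteSpace Y]
  [NormedAddCommGroup Z] [NormedSpace ℝ Z] [CompleteSpace Z]

/-- The product rule for primitives of integrable functions and a bilinear pairing. -/
lemma bilin_primitive (β : X →L[ℝ] Y →L[ℝ] Z) {τ : ℝ} (hτ : 0 ≤ τ) {f : ℝ → X} {g : ℝ → Y}
    (hf : IntegrableOn f (Ioc 0 τ)) (hg : IntegrableOn g (Ioc 0 τ)) :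
    IntegrableOn (fun t => β (f t) (∫ s in (0)..t, g s)) (Ioc 0 τ) ∧
    IntegrableOn (fun t => β (∫ s in (0)..t, f s) (g t)) (Ioc 0 τ) ∧
    β (∫ s in (0)..τ, f s) (∫ s in (0)..τ, g s) =
      (∫ t in Ioc 0 τ, β (f t) (∫ s in (0)..t, g s)) +
        ∫ t in Ioc 0 τ, β (∫ s in (0)..t, f s) (g t) := by
  set μ : Measure ℝ := volume.restrict (Ioc 0 τ) with hμ
  have hK : Integrable (fun z : ℝ × ℝ => β (f z.1) (g z.2)) (μ.prod μ) :=
    Integrable.op_fst_snd (op := fun x y => β x y) (by fun_prop) ⟨‖β‖, β.le_opNorm₂⟩ hf hg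
  -- The product of the two integrals is an integral over a square. Splitting the square along its
  -- diagonal and applying Fubini to each triangle gives the two terms.
  set A : Set (ℝ × ℝ) := {p | p.2 ≤ p.1} with hAdef
  have hA : MeasurableSet A := measurableSet_le measurable_snd measurable_fst
  have e1 : ∀ s ∈ Ioc 0 τ,
      ∫ t, A.indicator (fun z : ℝ × ℝ => β (f z.1) (g z.2)) (s, t) ∂μ
        = β (f s) (∫ t in (0)..s, g t) := by
    intro s hs
    have : (fun t => A.indicator (fun z : ℝ × ℝ => β (f z.1) (g z.2)) (s, t))
        = (Iic s).indicator (fun t => β (f s) (g t)) := by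
      ext t; simp [A, indicator]
    rw [this, integral_indicator measurableSet_Iic, hμ, Measure.restrict_restrict measurableSet_Iic,
      inter_comm, Ioc_inter_Iic, min_eq_right hs.2, intervalIntegral.integral_of_le hs.1.le,
      ContinuousLinearMap.integral_comp_comm]
    exact hg.mono_set (Ioc_subset_Ioc_right hs.2)
  have e2 : ∀ t ∈ Ioc 0 τ,
      ∫ s, Aᶜ.indicator (fun z : ℝ × ℝ => β (f z.1) (g z.2)) (s, t) ∂μ
        = β (∫ s in (0)..t, f s) (g t) := by
    intro t ht
    have : (fun s => Aᶜ.indicator (fun z : ℝ × ℝ => β (f z.1) (g z.2)) (s, t))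
        = (Iio t).indicator (fun s => β.flip (g t) (f s)) := by
      ext s; simp [A, indicator]
    have hset : Iio t ∩ Ioc 0 τ = Ioo 0 t := by
      ext s; simp only [mem_inter_iff, mem_Iio, mem_Ioc, mem_Ioo]
      have := ht.2
      constructor
      · rintro ⟨h1, h2, h3⟩; exact ⟨h2, h1⟩
      · rintro ⟨h1, h2⟩; exact ⟨h2, h1, by linarith⟩
    rw [this, integral_indicator measurableSet_Iio, hμ, Measure.restrict_restrict measurableSet_Iio,
      hset, intervalIntegral.integral_of_le ht.1.le, ← integral_Ioc_eq_integral_Ioo,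
      ContinuousLinearMap.integral_comp_comm]
    · rfl
    · exact hf.mono_set (Ioc_subset_Ioc_right ht.2)
  have i1 := hK.indicator hA
  have i2 := hK.indicator hA.compl
  have a1 : ∀ᵐ s ∂μ, ∫ t, A.indicator (fun z : ℝ × ℝ => β (f z.1) (g z.2)) (s, t) ∂μ
        = β (f s) (∫ t in (0)..s, g t) :=
    (ae_restrict_iff' measurableSet_Ioc).2 (Eventually.of_forall e1)
  have a2 : ∀ᵐ t ∂μ, ∫ s, Aᶜ.indicator (fun z : ℝ × ℝ => β (f z.1) (g z.2)) (s, t) ∂μ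
        = β (∫ s in (0)..t, f s) (g t) :=
    (ae_restrict_iff' measurableSet_Ioc).2 (Eventually.of_forall e2)
  refine ⟨i1.integral_prod_left.congr a1, i2.integral_prod_right.congr a2, ?_⟩
  rw [← integral_congr_ae a1, ← integral_congr_ae a2, ← integral_prod _ i1,
    ← integral_prod_symm _ i2, integral_indicator hA, integral_indicator hA.compl,
    integral_add_compl hA hK, integral_prod_bilin β hf hg,
    intervalIntegral.integral_of_le hτ, intervalIntegral.integral_of_le hτ]

lemma exists_Icc_superset {T : ℝ} (hT : 0 < T) {K : Set ℝ} (hK : IsCompact K)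
    (hKT : K ⊆ Ioo 0 T) : ∃ a b, 0 < a ∧ a ≤ b ∧ b < T ∧ K ⊆ Icc a b := by
  -- The midpoint is inserted so that extrema exist even when `K` is empty.
  have hc : IsCompact (insert (T / 2) K) := hK.insert _
  have hsub : insert (T / 2) K ⊆ Ioo 0 T :=
    insert_subset ⟨by linarith, by linarith⟩ hKT
  obtain ⟨a, ha, ha'⟩ := hc.exists_isLeast (insert_nonempty _ _)
  obtain ⟨b, hb, hb'⟩ := hc.exists_isGreatest (insert_nonempty _ _)
  exact ⟨a, b, (hsub ha).1, ha' hb, (hsub hb).2,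
    fun x hx => ⟨ha' (mem_insert_of_mem _ hx), hb' (mem_insert_of_mem _ hx)⟩⟩

lemma IsTestFunction.eq_zero {U : Set ℝ} {φ : ℝ → ℝ} (hφ : IsTestFunction U φ) {x : ℝ}
    (hx : x ∉ U) : φ x = 0 :=
  image_eq_zero_of_notMem_tsupport fun h => hx (hφ.tsupport_subset h)

lemma IsTestFunction.deriv {U : Set ℝ} {φ : ℝ → ℝ} (hφ : IsTestFunction U φ) :
    IsTestFunction U (deriv φ) :=
  ⟨(contDiff_infty_iff_deriv.1 hφ.contDiff).2, hφ.hasCompactSupport.deriv,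
    (closure_minimal (support_deriv_subset) (isClosed_tsupport _)).trans hφ.tsupport_subset⟩

lemma IsTestFunction.integral_deriv_eq {T : ℝ} {φ : ℝ → ℝ} (hφ : IsTestFunction (Ioo 0 T) φ)
    (t : ℝ) : ∫ s in (0)..t, _root_.deriv φ s = φ t := by
  rw [intervalIntegral.integral_deriv_eq_sub
    (fun x _ => hφ.contDiff.differentiable (by simp) x)
    (hφ.deriv.contDiff.continuous.intervalIntegrable _ _), hφ.eq_zero (x := 0) (by simp), sub_zero]

/-- A mean-free test function on an interval is the derivative of a test function. -/
lemma IsTestFunction.exists_primitive {T : ℝ} (hT : 0 < T) {θ : ℝ → ℝ}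
    (hθ : IsTestFunction (Ioo 0 T) θ) (h0 : ∫ t, θ t = 0) :
    ∃ φ, IsTestFunction (Ioo 0 T) φ ∧ _root_.deriv φ = θ := by
  obtain ⟨a, b, ha, hab, hb, hK⟩ :=
    exists_Icc_superset hT hθ.hasCompactSupport hθ.tsupport_subset
  have hz : ∀ s, s ∉ Icc a b → θ s = 0 := fun s hs =>
    image_eq_zero_of_notMem_tsupport fun h => hs (hK h)
  have hcont := hθ.contDiff.continuous
  have hderiv : _root_.deriv (fun t => ∫ s in (0)..t, θ s) = θ := by
    ext t; exact hcont.deriv_integral θ 0 t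
  have hsupp : Function.support (fun t => ∫ s in (0)..t, θ s) ⊆ Icc a b := by
    intro t ht
    by_contra hn
    apply ht
    rw [mem_Icc, not_and_or, not_le, not_le] at hn
    rcases hn with h | h
    · change ∫ s in (0)..t, θ s = 0
      rw [intervalIntegral.integral_congr (g := fun _ => 0), intervalIntegral.integral_zero]
      intro s hs
      refine hz s fun hs' => ?_
      rw [uIcc, mem_Icc] at hs
      have : s ≤ max 0 t := hs.2
      rcases max_cases 0 t with h' | h' <;> linarith [hs'.1]
    -- To the right of `b` the primitive has collected the whole integral of `θ`, which is zero.
    · change ∫ s in (0)..t, θ s = 0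
      rw [intervalIntegral.integral_of_le (by linarith), ← h0]
      refine setIntegral_eq_integral_of_forall_compl_eq_zero fun s hs => hz s fun hs' => hs ?_
      exact ⟨by linarith [hs'.1], by linarith [hs'.2]⟩
  refine ⟨_, ⟨contDiff_infty_iff_deriv.2 ⟨fun t =>
    (hcont.integral_hasStrictDerivAt 0 t).hasDerivAt.differentiableAt, by rw [hderiv]; exact hθ.contDiff⟩,
    HasCompactSupport.of_support_subset_isCompact isCompact_Icc hsupp, ?_⟩, hderiv⟩
  exact (closure_minimal hsupp isClosed_Icc).trans fun x hx =>
    ⟨by linarith [hx.1], by linarith [hx.2]⟩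

lemma IsTestFunction.exists_integral_eq_one {T : ℝ} (hT : 0 < T) :
    ∃ η, IsTestFunction (Ioo 0 T) η ∧ ∫ t, η t = 1 := by
  let f : ContDiffBump (T / 2 : ℝ) := ⟨T / 8, T / 4, by linarith, by linarith⟩
  refine ⟨f.normed volume, ⟨f.contDiff_normed, f.hasCompactSupport_normed, ?_⟩,
    f.integral_normed⟩
  rw [f.tsupport_normed_eq, Real.closedBall_eq_Icc]
  intro x hx
  have h1 : T / 2 - T / 4 ≤ x := hx.1
  have h2 : x ≤ T / 2 + T / 4 := hx.2
  exact ⟨by linarith, by linarith⟩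

lemma IsTestFunction.sub {U : Set ℝ} {φ ψ : ℝ → ℝ} (hφ : IsTestFunction U φ)
    (hψ : IsTestFunction U ψ) : IsTestFunction U (φ - ψ) :=
  ⟨hφ.contDiff.sub hψ.contDiff, hφ.hasCompactSupport.sub hψ.hasCompactSupport,
    (tsupport_sub φ ψ).trans (union_subset hφ.tsupport_subset hψ.tsupport_subset)⟩

lemma IsTestFunction.const_mul {U : Set ℝ} {φ : ℝ → ℝ} (c : ℝ) (hφ : IsTestFunction U φ) :
    IsTestFunction U (fun x => c * φ x) :=
  ⟨contDiff_const.mul hφ.contDiff, hφ.hasCompactSupport.mul_left,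
    (closure_mono (Function.support_mul_subset_right _ _)).trans hφ.tsupport_subset⟩

lemma IsTestFunction.integrable {U : Set ℝ} {φ : ℝ → ℝ} (hφ : IsTestFunction U φ) :
    Integrable φ :=
  hφ.contDiff.continuous.integrable_of_hasCompactSupport hφ.hasCompactSupport

omit [CompleteSpace X] in
lemma IsTestFunction.integrableOn_smul {U S : Set ℝ} {φ : ℝ → ℝ} (hφ : IsTestFunction U φ)
    {F : ℝ → X} (hF : IntegrableOn F S) : IntegrableOn (fun t => φ t • F t) S := by
  obtain ⟨C, hC⟩ := hφ.hasCompactSupport.exists_bound_of_continuous hφ.contDiff.continuous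
  exact hF.bdd_smul C hφ.contDiff.continuous.aestronglyMeasurable (Eventually.of_forall hC)

/-- The lemma of du Bois-Reymond. -/
lemma ae_eq_const_of_weak_deriv_zero {T : ℝ} (hT : 0 < T) {F : ℝ → X}
    (hF : IntegrableOn F (Ioo 0 T))
    (h : ∀ φ, IsTestFunction (Ioo 0 T) φ → ∫ t in Ioo 0 T, deriv φ t • F t = 0) :
    ∃ c, ∀ᵐ t ∂timeMeasure T, F t = c := by
  obtain ⟨η, hη, hη1⟩ := IsTestFunction.exists_integral_eq_one hT
  set c := ∫ t in Ioo 0 T, η t • F t with hc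
  refine ⟨c, ?_⟩
  have hFc : IntegrableOn (fun t => F t - c) (Ioo 0 T) := hF.sub (by simp)
  have key := isOpen_Ioo.ae_eq_zero_of_integral_contDiff_smul_eq_zero
    (μ := volume) (hFc.locallyIntegrableOn) (fun ψ h1 h2 h3 => ?_)
  · rw [ae_restrict_iff' measurableSet_Ioo]
    filter_upwards [key] with t ht hT
    exact sub_eq_zero.1 (ht hT)
  have hψ : IsTestFunction (Ioo 0 T) ψ := ⟨h1, h2, h3⟩
  -- Subtracting a multiple of `η` makes `ψ` mean-free, hence a derivative to which `h` applies. The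
  -- subtracted multiple accounts for the constant `c`, the `η`-average of `F`.
  obtain ⟨φ, hφ, hφ'⟩ := (hψ.sub (hη.const_mul (∫ t, ψ t))).exists_primitive hT (by
    simp only [Pi.sub_apply]
    rw [integral_sub hψ.integrable (hη.integrable.const_mul _), integral_const_mul, hη1]
    ring)
  have := h φ hφ
  rw [hφ'] at this
  rw [← setIntegral_eq_integral_of_forall_compl_eq_zero (s := Ioo 0 T) fun t ht => by
    rw [hψ.eq_zero ht, zero_smul]]
  simp only [smul_sub]
  rw [integral_sub (hψ.integrableOn_smul hF) (hψ.integrableOn_smul (by simp)),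
    integral_smul_const, hc, ← integral_smul,
    setIntegral_eq_integral_of_forall_compl_eq_zero (f := ψ) (fun t ht => hψ.eq_zero ht),
    ← integral_sub (g := fun t => (∫ t, ψ t) • η t • F t) (hψ.integrableOn_smul hF) ((hη.integrableOn_smul hF).smul (∫ t, ψ t)), ← this]
  congr 1
  ext t
  simp [sub_smul, mul_smul]

omit [CompleteSpace X] in
lemma continuousOn_primitive_Icc {T : ℝ} (hT : 0 ≤ T) {h : ℝ → X} (hh : IntegrableOn h (Ioc 0 T)) :
    ContinuousOn (fun t => ∫ s in (0)..t, h s) (Icc 0 T) := by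
  have := intervalIntegral.continuousOn_primitive_interval (μ := volume) (f := h) (a := 0) (b := T)
    (by rw [uIcc_of_le hT]; exact (integrableOn_Icc_iff_integrableOn_Ioc (by simp)).2 hh)
  rwa [uIcc_of_le hT] at this

/-- A function with an integrable weak time derivative is the primitive of its derivative. -/
lemma HasWeakTimeDeriv.ae_eq_primitive {T : ℝ} (hT : 0 < T) {f h : ℝ → X} {x₀ : X}
    (hf : IntegrableOn f (Ioo 0 T)) (hh : IntegrableOn h (Ioo 0 T))
    (hd : HasWeakTimeDeriv T f h) (hi : HasInitialValue T f x₀) :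
    ∀ᵐ t ∂timeMeasure T, f t = x₀ + ∫ s in (0)..t, h s := by
  have hh' : IntegrableOn h (Ioc 0 T) := (integrableOn_Ioc_iff_integrableOn_Ioo (by simp)).2 hh
  have hcont := continuousOn_primitive_Icc hT.le hh'
  have hH : IntegrableOn (fun t => ∫ s in (0)..t, h s) (Ioo 0 T) :=
    (hcont.integrableOn_compact isCompact_Icc).mono_set Ioo_subset_Icc_self
  -- The difference has zero weak derivative: the product rule for the primitives of `deriv φ` and
  -- `h` has no boundary term, as `φ` vanishes at `T`.
  obtain ⟨c, hc⟩ := ae_eq_const_of_weak_deriv_zero hT (F := fun t => f t - ∫ s in (0)..t, h s)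
    (hf.sub hH) (fun φ hφ => by
      obtain ⟨-, -, h3⟩ := bilin_primitive (ContinuousLinearMap.lsmul ℝ ℝ (E := X)) hT.le
        (f := deriv φ) (g := h) hφ.deriv.integrable.integrableOn hh'
      simp only [hφ.integral_deriv_eq, hφ.eq_zero (x := T) (by simp), map_zero,
        zero_apply, ContinuousLinearMap.lsmul_apply,
        integral_Ioc_eq_integral_Ioo] at h3
      simp only [smul_sub]
      rw [integral_sub (hφ.deriv.integrableOn_smul hf) (hφ.deriv.integrableOn_smul hH), hd φ hφ,
        ← neg_add', add_comm, ← h3, neg_zero])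
  obtain ⟨U, hU, hUf, hU0⟩ := hi
  -- Both sides are continuous on the closed interval, so equality almost everywhere extends to the
  -- endpoint 0 and identifies `c` with the initial value.
  have hEq : EqOn U (fun t => c + ∫ s in (0)..t, h s) (Icc 0 T) := by
    have hae : U =ᵐ[volume.restrict (Icc 0 T)] fun t => c + ∫ s in (0)..t, h s := by
      rw [← restrict_Ioo_eq_restrict_Icc]
      filter_upwards [hUf, hc] with t h1 h2
      rw [h1, ← h2]; abel
    exact Measure.eqOn_Icc_of_ae_eq volume hT.ne hae hU (continuousOn_const.add hcont)
  have h0 := hEq (left_mem_Icc.2 hT.le)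
  simp only [intervalIntegral.integral_same, add_zero, hU0] at h0
  filter_upwards [hc] with t ht
  rw [h0, ← ht]; abel

end Primitive

/-! ### An estimate for abstract wave equations -/

section AbstractWave

variable {V H : Type*} [NormedAddCommGroup V] [InnerProductSpace ℝ V] [CompleteSpace V]
  [NormedAddCommGroup H] [InnerProductSpace ℝ H] [CompleteSpace H]

omit [CompleteSpace V] in
lemma abs_bilin_le_sqrt_mul_sqrt (b : V →L[ℝ] V →L[ℝ] ℝ) (hsymm : ∀ v w, b v w = b w v)
    (hpos : ∀ v, 0 ≤ b v v) (v w : V) : |b v w| ≤ √(b v v) * √(b w w) := by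
  rw [← Real.sqrt_mul (hpos v)]
  refine Real.abs_le_sqrt ?_
  exact LinearMap.BilinForm.apply_sq_le_of_symm b.toLinearMap₁₂ hpos ⟨hsymm⟩ v w

/-- The data of a weak solution of `u_tt + B u = 0` with initial values `u₀`, `v₀`, integrated in
time: `d = u_t - v₀`, and `b` is the bilinear form of `B`. -/
structure IntegratedWave (T : ℝ) (ι : V →L[ℝ] H) (b : V →L[ℝ] V →L[ℝ] ℝ) (u₀ v₀ : V)
    (u : ℝ → V) (d : ℝ → H) : Prop where
  pos : 0 < T
  symm : ∀ v w, b v w = b w v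
  nonneg : ∀ v, 0 ≤ b v v
  le_norm : ∀ v, b v v ≤ ‖v‖ ^ 2
  integrable : IntegrableOn u (Ioc 0 T)
  integrable_deriv : IntegrableOn d (Ioc 0 T)
  eq_primitive : ∀ᵐ t ∂volume.restrict (Ioc 0 T),
    ι (u t) = ι (u₀ + t • v₀) + ∫ s in (0)..t, d s
  weak : ∀ᵐ t ∂volume.restrict (Ioc 0 T), ∀ v, inner ℝ (d t) (ι v) = -b (∫ s in (0)..t, u s) v

namespace IntegratedWave

variable {T : ℝ} {ι : V →L[ℝ] H} {b : V →L[ℝ] V →L[ℝ] ℝ} {u₀ v₀ : V} {u : ℝ → V} {d : ℝ → H}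

omit [CompleteSpace V] [CompleteSpace H] in
lemma integrable_primitive (h : IntegratedWave T ι b u₀ v₀ u d) :
    IntegrableOn (fun t => ∫ s in (0)..t, u s) (Ioc 0 T) :=
  ((continuousOn_primitive_Icc h.pos.le h.integrable).integrableOn_compact isCompact_Icc).mono_set
    Ioc_subset_Icc_self

/-- The twice integrated equation. -/
lemma inner_primitive (h : IntegratedWave T ι b u₀ v₀ u d) {τ : ℝ} (hτ : τ ∈ Icc 0 T) (v : V) :
    inner ℝ (∫ t in (0)..τ, d t) (ι v) = -b (∫ t in (0)..τ, ∫ s in (0)..t, u s) v := by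
  have hsub : Ioc 0 τ ⊆ Ioc 0 T := Ioc_subset_Ioc_right hτ.2
  rw [intervalIntegral.integral_of_le hτ.1, intervalIntegral.integral_of_le hτ.1,
    real_inner_comm]
  change innerSL ℝ (ι v) _ = - b.flip v _
  rw [← ContinuousLinearMap.integral_comp_comm _ (h.integrable_deriv.mono_set hsub),
    ← ContinuousLinearMap.integral_comp_comm _ (h.integrable_primitive.mono_set hsub),
    ← integral_neg]
  refine integral_congr_ae ?_
  filter_upwards [ae_restrict_of_ae_restrict_of_subset hsub h.weak] with t ht
  rw [innerSL_apply_apply, real_inner_comm, ht v]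
  rfl

/-- The energy identity of the integrated equation. -/
lemma energy (h : IntegratedWave T ι b u₀ v₀ u d) {τ : ℝ} (hτ : τ ∈ Icc 0 T) :
    ‖∫ t in (0)..τ, d t‖ ^ 2 + b (∫ t in (0)..τ, u t) (∫ t in (0)..τ, u t) =
      2 * (b (∫ t in (0)..τ, ∫ s in (0)..t, u s) (u₀ + τ • v₀) -
        ∫ t in Ioc 0 τ, b (∫ s in (0)..t, ∫ r in (0)..s, u r) v₀) := by
  have hsub : Ioc 0 τ ⊆ Ioc 0 T := Ioc_subset_Ioc_right hτ.2
  have hu := h.integrable.mono_set hsub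
  have hd := h.integrable_deriv.mono_set hsub
  have hU := h.integrable_primitive.mono_set hsub
  have e1 : inner ℝ (∫ t in (0)..τ, d t) (∫ t in (0)..τ, d t) =
      (∫ t in Ioc 0 τ, inner ℝ (d t) (∫ s in (0)..t, d s)) +
        ∫ t in Ioc 0 τ, inner ℝ (∫ s in (0)..t, d s) (d t) :=
    (bilin_primitive (innerSL ℝ (E := H)) hτ.1 hd hd).2.2
  obtain ⟨i2, -, e2⟩ := bilin_primitive b hτ.1 hu hu
  -- Integration by parts in time against t v₀, so that only the double primitive of `u` meets the
  -- data; for it the twice integrated equation is available.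
  obtain ⟨i3, -, e3⟩ := bilin_primitive b hτ.1 hU (g := fun _ => v₀) (by simp)
  simp only [intervalIntegral.integral_const, sub_zero] at i3 e3
  have c1 : ∫ t in Ioc 0 τ, inner ℝ (∫ s in (0)..t, d s) (d t)
      = ∫ t in Ioc 0 τ, inner ℝ (d t) (∫ s in (0)..t, d s) := by simp_rw [real_inner_comm]
  have c2 : ∫ t in Ioc 0 τ, b (∫ s in (0)..t, u s) (u t)
      = ∫ t in Ioc 0 τ, b (u t) (∫ s in (0)..t, u s) := by simp_rw [h.symm _ (u _)]
  have c4 : b (∫ t in (0)..τ, ∫ s in (0)..t, u s) u₀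
      = ∫ t in Ioc 0 τ, b (∫ s in (0)..t, u s) u₀ := by
    rw [intervalIntegral.integral_of_le hτ.1]
    change b.flip u₀ _ = _
    rw [← ContinuousLinearMap.integral_comp_comm _ hU]
    rfl
  have i4 : IntegrableOn (fun t => b (∫ s in (0)..t, u s) u₀) (Ioc 0 τ) :=
    (b.flip u₀).integrable_comp hU
  -- The primitive of `d` is the image of u - u₀ - t v₀, which lies in `V` and is therefore an
  -- admissible test vector.
  have key : ∫ t in Ioc 0 τ, inner ℝ (d t) (∫ s in (0)..t, d s)
      = ∫ t in Ioc 0 τ, (b (∫ s in (0)..t, u s) u₀ + b (∫ s in (0)..t, u s) (t • v₀)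
          - b (u t) (∫ s in (0)..t, u s)) := by
    refine integral_congr_ae ?_
    filter_upwards [ae_restrict_of_ae_restrict_of_subset hsub h.weak,
      ae_restrict_of_ae_restrict_of_subset hsub h.eq_primitive] with t h1 h2
    have : ∫ s in (0)..t, d s = ι (u t - (u₀ + t • v₀)) := by rw [map_sub, h2]; abel
    rw [this, h1, map_sub, map_add, h.symm _ (u t)]
    ring
  have i34 : IntegrableOn (fun t => b (∫ s in (0)..t, u s) u₀ + b (∫ s in (0)..t, u s) (t • v₀))
    (Ioc 0 τ) := i4.add i3
  rw [integral_sub i34 i2, integral_add i4 i3] at key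
  rw [real_inner_self_eq_norm_sq, c1] at e1
  rw [c2] at e2
  rw [map_add, c4]
  linarith

omit [CompleteSpace H] in
-- Here `m` is the maximum over time of the energy seminorm of ∫ u. Cauchy–Schwarz for `b` under one
-- more time integral gives the estimate. That the maximum is attained allows the energy identity to
-- be evaluated at `τ` and to bound `m` itself.
lemma exists_bound (h : IntegratedWave T ι b u₀ v₀ u d) :
    ∃ m, 0 ≤ m ∧ (∃ τ ∈ Icc 0 T, b (∫ t in (0)..τ, u t) (∫ t in (0)..τ, u t) = m ^ 2) ∧
      ∀ t ∈ Icc 0 T, ∀ v, |b (∫ s in (0)..t, ∫ r in (0)..s, u r) v| ≤ T * m * √(b v v) := by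
  have hc := continuousOn_primitive_Icc h.pos.le h.integrable
  obtain ⟨t₀, ht₀, hmax⟩ := isCompact_Icc.exists_isMaxOn (nonempty_Icc.2 h.pos.le)
    (f := fun t => b (∫ s in (0)..t, u s) (∫ s in (0)..t, u s))
    ((b.continuous.comp_continuousOn hc).clm_apply hc)
  refine ⟨√(b (∫ t in (0)..t₀, u t) (∫ t in (0)..t₀, u t)), Real.sqrt_nonneg _,
    ⟨t₀, ht₀, (Real.sq_sqrt (h.nonneg _)).symm⟩, fun t ht v => ?_⟩
  have hsub : Ioc 0 t ⊆ Ioc 0 T := Ioc_subset_Ioc_right ht.2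
  set m := √(b (∫ t in (0)..t₀, u t) (∫ t in (0)..t₀, u t))
  have : b (∫ s in (0)..t, ∫ r in (0)..s, u r) v = ∫ s in (0)..t, b (∫ r in (0)..s, u r) v := by
    rw [intervalIntegral.integral_of_le ht.1, intervalIntegral.integral_of_le ht.1]
    change b.flip v _ = _
    rw [← ContinuousLinearMap.integral_comp_comm _ (h.integrable_primitive.mono_set hsub)]
    rfl
  rw [this]
  have hb := intervalIntegral.norm_integral_le_of_norm_le_const (a := 0) (b := t)
    (f := fun s => b (∫ r in (0)..s, u r) v) (C := m * √(b v v)) (fun s hs => by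
      rw [uIoc_of_le ht.1] at hs
      refine (abs_bilin_le_sqrt_mul_sqrt b h.symm h.nonneg _ _).trans ?_
      gcongr
      exact Real.sqrt_le_sqrt (hmax (Ioc_subset_Icc_self (hsub hs))))
  rw [Real.norm_eq_abs, sub_zero, abs_of_nonneg ht.1] at hb
  refine hb.trans ?_
  have hm : 0 ≤ m * √(b v v) := by positivity
  nlinarith [ht.2]

/-- If `b (∫∫ u) u₀` and `b (∫∫ u) v₀` are bounded by `C`, then `u - u₀ - t v₀` is bounded. -/
lemma energy_le (h : IntegratedWave T ι b u₀ v₀ u d) {C₀ C₁ : ℝ}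
    (hC₀ : ∀ t ∈ Icc 0 T, |b (∫ s in (0)..t, ∫ r in (0)..s, u r) u₀| ≤ C₀)
    (hC₁ : ∀ t ∈ Icc 0 T, |b (∫ s in (0)..t, ∫ r in (0)..s, u r) v₀| ≤ C₁)
    {τ : ℝ} (hτ : τ ∈ Icc 0 T) :
    ‖∫ t in (0)..τ, d t‖ ^ 2 + b (∫ t in (0)..τ, u t) (∫ t in (0)..τ, u t) ≤
      2 * (C₀ + 2 * T * C₁) := by
  rw [h.energy hτ]
  -- The term with τ v₀ and this time integral contribute at most T C₁ each.
  have hb := norm_setIntegral_le_of_norm_le_const (μ := volume) (s := Ioc 0 τ)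
    (f := fun t => b (∫ s in (0)..t, ∫ r in (0)..s, u r) v₀) (C := C₁) (by simp)
    (fun t ht => hC₁ t ⟨ht.1.le, ht.2.trans hτ.2⟩)
  have hvol : volume.real (Ioc 0 τ) = τ := by simp [hτ.1]
  rw [Real.norm_eq_abs, hvol] at hb
  rw [map_add, map_smul, smul_eq_mul]
  have h1 := (abs_le.1 (hC₀ τ hτ)).2
  have h2 := (abs_le.1 (hC₁ τ hτ)).2
  have h3 := (abs_le.1 hb).1
  have hC : 0 ≤ C₁ := (abs_nonneg _).trans (hC₁ τ hτ)
  nlinarith [hτ.1, hτ.2, mul_le_mul_of_nonneg_left h2 hτ.1, mul_le_mul_of_nonneg_right hτ.2 hC]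

omit [CompleteSpace V] [CompleteSpace H] in
lemma sqrt_le_norm (h : IntegratedWave T ι b u₀ v₀ u d) (v : V) : √(b v v) ≤ ‖v‖ :=
  Real.sqrt_le_iff.2 ⟨norm_nonneg _, h.le_norm v⟩

/-- The bound of the deviation from `u₀ + t v₀` in terms of the data. -/
def bound (T : ℝ) (u₀ v₀ : V) : ℝ := 2 * (T * (‖u₀‖ + 2 * T * ‖v₀‖))

/-- The deviation from `u₀ + t v₀` is bounded, and it is small if `u₀` and `v₀` can be approximated
in `H` by vectors of small energy. -/
lemma norm_primitive_le (h : IntegratedWave T ι b u₀ v₀ u d) :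
    (∀ τ ∈ Icc 0 T, ‖∫ t in (0)..τ, d t‖ ≤ bound T u₀ v₀) ∧
    ∀ δ : ℝ, 0 ≤ δ → ∀ u₁ v₁ : V, ‖ι (u₀ - u₁)‖ ≤ δ → √(b u₁ u₁) ≤ δ → ‖ι (v₀ - v₁)‖ ≤ δ →
      √(b v₁ v₁) ≤ δ → ∀ τ ∈ Icc 0 T,
        ‖∫ t in (0)..τ, d t‖ ^ 2 ≤ 2 * (1 + 2 * T) * (1 + T) * bound T u₀ v₀ * δ := by
  obtain ⟨m, hm, ⟨t₀, ht₀, hmt⟩, hbd⟩ := h.exists_bound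
  have hT := h.pos
  have hE := fun τ (hτ : τ ∈ Icc 0 T) => h.energy_le (C₀ := T * m * ‖u₀‖) (C₁ := T * m * ‖v₀‖)
    (fun t ht => (hbd t ht u₀).trans (by gcongr; exact h.sqrt_le_norm _))
    (fun t ht => (hbd t ht v₀).trans (by gcongr; exact h.sqrt_le_norm _)) hτ
  have hK : 0 ≤ bound T u₀ v₀ := by unfold bound; positivity
  have hEq : 2 * (T * m * ‖u₀‖ + 2 * T * (T * m * ‖v₀‖)) = m * bound T u₀ v₀ := by
    unfold bound; ring
  -- At the maximising time the energy estimate gives m² ≤ m · `bound T u₀ v₀`.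
  have hmK : m ≤ bound T u₀ v₀ := by
    have := hE t₀ ht₀
    rw [hmt, hEq] at this
    by_contra! hlt
    nlinarith [sq_nonneg ‖∫ t in (0)..t₀, d t‖]
  have hz : ∀ τ ∈ Icc 0 T, ‖∫ t in (0)..τ, d t‖ ≤ bound T u₀ v₀ := by
    intro τ hτ
    have := hE τ hτ
    rw [hEq] at this
    refine abs_le_of_sq_le_sq' ?_ hK |>.2
    nlinarith [h.nonneg (∫ t in (0)..τ, u t)]
  refine ⟨hz, fun δ hδ u₁ v₁ hu hu' hv hv' τ hτ => ?_⟩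
  -- The part v - v' is small only in `H`, so the twice integrated equation turns its `b`-pairing
  -- into an inner product in `H`. The part v' is handled by its small energy.
  have aux : ∀ v v' : V, ‖ι (v - v')‖ ≤ δ → √(b v' v') ≤ δ → ∀ t ∈ Icc 0 T,
      |b (∫ s in (0)..t, ∫ r in (0)..s, u r) v| ≤ (1 + T) * bound T u₀ v₀ * δ := by
    intro v v' h1 h2 t ht
    have e : b (∫ s in (0)..t, ∫ r in (0)..s, u r) v =
        -inner ℝ (∫ s in (0)..t, d s) (ι (v - v')) +
          b (∫ s in (0)..t, ∫ r in (0)..s, u r) v' := by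
      rw [h.inner_primitive ht, map_sub]; ring
    rw [e]
    calc _ ≤ |inner ℝ (∫ s in (0)..t, d s) (ι (v - v'))| +
          |b (∫ s in (0)..t, ∫ r in (0)..s, u r) v'| := by
            refine (abs_add_le _ _).trans_eq (by rw [abs_neg])
      _ ≤ bound T u₀ v₀ * δ + T * bound T u₀ v₀ * δ := by
        gcongr
        · exact (abs_real_inner_le_norm _ _).trans (by gcongr; exact hz t ht)
        · exact (hbd t ht v').trans (by gcongr)
      _ = _ := by ring
  have := h.energy_le (aux u₀ u₁ hu hu') (aux v₀ v₁ hv hv') hτ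
  nlinarith [h.nonneg (∫ t in (0)..τ, u t)]

end IntegratedWave

end AbstractWave

/-! ### The bilinear form and correctors -/

section Form

variable {Ω : Set ℝ}

lemma norm_toL2_le (v : H10 Ω) : ‖toL2 Ω v‖ ≤ ‖v‖ := WithLp.norm_fst_le _ (toPair Ω v)

lemma norm_grad_le (v : H10 Ω) : ‖grad Ω v‖ ≤ ‖v‖ := WithLp.norm_snd_le _ (toPair Ω v)

/-- Multiplication by a measurable function with values in `[0,1]`, as an operator on `L²`. -/
lemma exists_mulOperator {a : ℝ → ℝ} (ha : Measurable a) (h0 : ∀ x, 0 ≤ a x) (h1 : ∀ x, a x ≤ 1) :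
    ∃ M : L2 Ω →L[ℝ] L2 Ω, (∀ f, ‖M f‖ ≤ ‖f‖) ∧
      ∀ f, M f =ᵐ[volume.restrict Ω] fun x => a x * f x := by
  have hmem : ∀ f : L2 Ω, MemLp (fun x => a x * f x) 2 (volume.restrict Ω) := fun f =>
    (Lp.memLp f).of_le (ha.aestronglyMeasurable.mul (Lp.aestronglyMeasurable f))
      (Eventually.of_forall fun x => by
        rw [norm_mul, Real.norm_of_nonneg (h0 x)]
        exact mul_le_of_le_one_left (norm_nonneg _) (h1 x))
  let L : L2 Ω →ₗ[ℝ] L2 Ω :=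
    { toFun := fun f => (hmem f).toLp
      map_add' := fun f g => by
        rw [← MemLp.toLp_add]
        refine (MemLp.toLp_eq_toLp_iff _ _).2 ?_
        filter_upwards [Lp.coeFn_add f g] with x hx
        rw [Pi.add_apply, hx, Pi.add_apply, mul_add]
      map_smul' := fun c f => by
        rw [RingHom.id_apply, ← MemLp.toLp_const_smul]
        refine (MemLp.toLp_eq_toLp_iff _ _).2 ?_
        filter_upwards [Lp.coeFn_smul c f] with x hx
        simp only [hx, Pi.smul_apply, smul_eq_mul]
        ring }
  have hb : ∀ f, ‖L f‖ ≤ ‖f‖ := fun f => by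
    refine Lp.norm_le_norm_of_ae_le ?_
    filter_upwards [(hmem f).coeFn_toLp] with x hx
    change ‖((hmem f).toLp : ℝ → ℝ) x‖ ≤ _
    rw [hx, norm_mul, Real.norm_of_nonneg (h0 x)]
    exact mul_le_of_le_one_left (norm_nonneg _) (h1 x)
  refine ⟨L.mkContinuous 1 fun f => by simpa using hb f, hb, fun f => (hmem f).coeFn_toLp⟩

/-- The form `bilin`, as a bounded bilinear form. -/
lemma exists_continuous_bilin {a : ℝ → ℝ} (ha : Measurable a) (h0 : ∀ x, 0 ≤ a x)
    (h1 : ∀ x, a x ≤ 1) :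
    ∃ b : H10 Ω →L[ℝ] H10 Ω →L[ℝ] ℝ, (∀ v w, b v w = bilin Ω a v w) ∧ (∀ v w, b v w = b w v) ∧
      (∀ v, 0 ≤ b v v) ∧ ∀ v, b v v ≤ ‖v‖ ^ 2 := by
  obtain ⟨M, hM, hMa⟩ := exists_mulOperator (Ω := Ω) ha h0 h1
  have hin : ∀ v w : H10 Ω, inner ℝ (M (grad Ω v)) (grad Ω w) = bilin Ω a v w := by
    intro v w
    rw [L2.inner_def, bilin]
    refine integral_congr_ae ?_
    filter_upwards [hMa (grad Ω v)] with x hx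
    rw [hx]
    simp [mul_comm]
  let b : H10 Ω →L[ℝ] H10 Ω →L[ℝ] ℝ :=
    ((innerSL ℝ (E := L2 Ω) : L2 Ω →L[ℝ] L2 Ω →L[ℝ] ℝ).bilinearComp (M.comp (grad Ω)) (grad Ω))
  have hb : ∀ v w, b v w = bilin Ω a v w := fun v w => hin v w
  refine ⟨b, hb, fun v w => ?_, fun v => ?_, fun v => ?_⟩
  · rw [hb, hb, bilin, bilin]
    congr 1 with x
    ring
  · rw [hb, bilin]
    exact integral_nonneg fun x => by
      rw [mul_assoc]
      exact mul_nonneg (h0 x) (mul_self_nonneg _)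
  · rw [hb, ← hin]
    calc _ ≤ ‖M (grad Ω v)‖ * ‖grad Ω v‖ := real_inner_le_norm _ _
      _ ≤ ‖v‖ * ‖v‖ := by
        gcongr
        · exact (hM _).trans (norm_grad_le v)
        · exact norm_grad_le v
      _ = _ := (sq _).symm

lemma isOpen_inclusions {ε : ℝ} (hε : ε ≠ 0) {S : Set ℝ} (hΩ : IsOpen Ω) (hS : IsOpen S) :
    IsOpen (inclusions ε S Ω) := by
  refine (isOpen_iUnion fun j => ?_).inter hΩ
  have : (fun y : ℝ => ε * ((j : ℝ) + y)) = fun y => (Homeomorph.mulLeft₀ ε hε) (Homeomorph.addLeft (j : ℝ) y) := by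
    ext y; simp
  rw [this, ← image_image]
  exact (Homeomorph.mulLeft₀ ε hε).isOpenMap _ ((Homeomorph.addLeft (j : ℝ)).isOpenMap _ hS)

lemma measurable_coeff {a₀ ε : ℝ} (hε : ε ≠ 0) {S : Set ℝ} (hΩ : IsOpen Ω) (hS : IsOpen S) :
    Measurable (coeff a₀ ε S Ω) := by
  classical
  have : coeff a₀ ε S Ω = fun x => if x ∈ inclusions ε S Ω then a₀ else 1 := by
    ext x; unfold coeff; congr
  rw [this]
  exact Measurable.ite (isOpen_inclusions hε hΩ hS).measurableSet measurable_const measurable_const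

/-- Test functions are elements of `H^1_0`. -/
lemma IsTestFunction.exists_H10 {φ : ℝ → ℝ} (hφ : IsTestFunction Ω φ) :
    ∃ v : H10 Ω, toL2 Ω v =ᵐ[volume.restrict Ω] φ ∧
      grad Ω v =ᵐ[volume.restrict Ω] _root_.deriv φ := by
  have m1 : MemLp φ 2 (volume.restrict Ω) :=
    (hφ.contDiff.continuous.memLp_of_hasCompactSupport hφ.hasCompactSupport).restrict Ω
  have m2 : MemLp (_root_.deriv φ) 2 (volume.restrict Ω) :=
    (hφ.deriv.contDiff.continuous.memLp_of_hasCompactSupport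
      hφ.deriv.hasCompactSupport).restrict Ω
  have hmem : WithLp.toLp 2 (m1.toLp, m2.toLp) ∈ testGraph Ω := ⟨φ, hφ, m1.coeFn_toLp, m2.coeFn_toLp⟩
  exact ⟨(⟨_, subset_closure hmem⟩ : (testGraph Ω).topologicalClosure), m1.coeFn_toLp,
    m2.coeFn_toLp⟩

/-- Test functions are dense in `H^1_0`. -/
lemma exists_testFunction_near (v : H10 Ω) {δ : ℝ} (hδ : 0 < δ) :
    ∃ (φ : ℝ → ℝ) (w : H10 Ω), IsTestFunction Ω φ ∧ toL2 Ω w =ᵐ[volume.restrict Ω] φ ∧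
      ‖v - w‖ < δ := by
  have hv : toPair Ω v ∈ closure (testGraph Ω : Set (WithLp 2 (L2 Ω × L2 Ω))) := v.2
  obtain ⟨p, ⟨φ, hφ, h1, h2⟩, hp⟩ := Metric.mem_closure_iff.1 hv δ hδ
  refine ⟨φ, (⟨p, subset_closure ⟨φ, hφ, h1, h2⟩⟩ : (testGraph Ω).topologicalClosure), hφ, h1, ?_⟩
  rw [dist_eq_norm] at hp
  exact hp

lemma setIntegral_le_of_support {g : ℝ → ℝ} {K : Set ℝ} (hK : IsCompact K) {C : ℝ}
    (hg0 : ∀ᵐ x ∂volume.restrict Ω, 0 ≤ g x) (hg : ∀ᵐ x ∂volume.restrict Ω, x ∈ K → g x ≤ C)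
    (hgK : ∀ᵐ x ∂volume.restrict Ω, x ∉ K → g x = 0) (hC : 0 ≤ C) :
    ∫ x in Ω, g x ≤ C * volume.real K := by
  have hi : Integrable (K.indicator fun _ => C) :=
    (integrable_indicator_iff hK.measurableSet).2 (integrableOn_const hK.measure_lt_top.ne)
  calc ∫ x in Ω, g x ≤ ∫ x in Ω, K.indicator (fun _ => C) x := by
        refine integral_mono_of_nonneg hg0 hi.integrableOn ?_
        filter_upwards [hg, hgK] with x h1 h2
        by_cases hx : x ∈ K
        · simpa [hx] using h1 hx
        · simp [hx, h2 hx]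
    _ ≤ ∫ x, K.indicator (fun _ => C) x :=
        setIntegral_le_integral hi (Eventually.of_forall fun x => indicator_nonneg (fun _ _ => hC) x)
    _ = C * volume.real K := by
        rw [integral_indicator hK.measurableSet, setIntegral_const, smul_eq_mul, mul_comm]

lemma norm_L2_le_of_support {f : L2 Ω} {K : Set ℝ} (hK : IsCompact K) {C : ℝ} (hC : 0 ≤ C)
    (hf : ∀ᵐ x ∂volume.restrict Ω, |f x| ≤ C)
    (hfK : ∀ᵐ x ∂volume.restrict Ω, x ∉ K → f x = 0) :
    ‖f‖ ≤ C * √(volume.real K) := by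
  have h : ‖f‖ ^ 2 ≤ C ^ 2 * volume.real K := by
    rw [← real_inner_self_eq_norm_sq, L2.inner_def]
    refine setIntegral_le_of_support hK (Eventually.of_forall fun x => real_inner_self_nonneg)
      ?_ ?_ (sq_nonneg C)
    · filter_upwards [hf] with x hx _
      rw [real_inner_self_eq_norm_sq]
      gcongr
      exact hx
    · filter_upwards [hfK] with x hx hxK
      simp [hx hxK]
  calc ‖f‖ ≤ √(C ^ 2 * volume.real K) := Real.le_sqrt_of_sq_le h
    _ = _ := by rw [Real.sqrt_mul (sq_nonneg _), Real.sqrt_sq hC]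

/-- A smooth function close to the identity which is locally constant outside the periodic
extension of `S`. -/
lemma exists_staircase {S : Set ℝ} (hS : IsOpen S) (hSne : S.Nonempty) (hSY : S ⊆ unitCell) :
    ∃ χ : ℝ → ℝ, ContDiff ℝ ∞ χ ∧ (∀ y, |χ y - y| ≤ 1) ∧
      (∃ C, ∀ y, |deriv χ y| ≤ C) ∧
      ∀ y, deriv χ y ≠ 0 → ∃ j : ℤ, ∃ s ∈ S, y = j + s := by
  obtain ⟨c, hc⟩ := hSne
  obtain ⟨r, hr, hrS⟩ := Metric.nhds_basis_closedBall.mem_iff.1 (hS.mem_nhds hc)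
  rw [Real.closedBall_eq_Icc] at hrS
  obtain ⟨p, hp⟩ : ∃ p, p = c - r := ⟨_, rfl⟩
  obtain ⟨q, hq⟩ : ∃ q, q = c + r := ⟨_, rfl⟩
  rw [← hp, ← hq] at hrS
  have hpq : p < q := by linarith
  have hp0 : 0 < p := (hSY (hrS (left_mem_Icc.2 hpq.le))).1
  have hq1 : q < 1 := (hSY (hrS (right_mem_Icc.2 hpq.le))).2
  -- A smooth step from 0 to 1 inside [p, q] ⊆ S; the staircase is ⌊y⌋ + s(fract y).
  set s : ℝ → ℝ := fun y => Real.smoothTransition ((y - p) / (q - p)) with hs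
  have hsd : ContDiff ℝ ∞ s :=
    Real.smoothTransition.contDiff.comp ((contDiff_id.sub contDiff_const).div_const _)
  have s0 : ∀ y ≤ p, s y = 0 := fun y hy =>
    Real.smoothTransition.zero_of_nonpos (div_nonpos_of_nonpos_of_nonneg (by linarith) (by linarith))
  have s1 : ∀ y, q ≤ y → s y = 1 := fun y hy =>
    Real.smoothTransition.one_of_one_le ((one_le_div (by linarith)).2 (by linarith))
  -- At an integer the jump of the floor cancels the drop of `s` from 1 to 0. One smooth formula
  -- thus holds on an open interval containing [n, n + 1], which makes the staircase smooth.
  have hloc : ∀ (n : ℤ) (y : ℝ), y ∈ Ioo (n - 1 + q) (n + 1 + p) →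
      (⌊y⌋ : ℝ) + s (Int.fract y) = n + s (y - n) := by
    rintro n y ⟨h1, h2⟩
    rcases lt_or_ge y n with h | h
    · have hf : ⌊y⌋ = n - 1 := Int.floor_eq_iff.2 ⟨by push_cast; linarith, by push_cast; linarith⟩
      have : Int.fract y = y - n + 1 := by rw [Int.fract, hf]; push_cast; ring
      rw [this, hf, s1 _ (by linarith), s0 _ (by linarith)]; push_cast; ring
    rcases lt_or_ge y (n + 1) with h' | h'
    · have hf : ⌊y⌋ = n := Int.floor_eq_iff.2 ⟨h, h'⟩
      rw [Int.fract, hf]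
    · have hf : ⌊y⌋ = n + 1 := Int.floor_eq_iff.2 ⟨by push_cast; linarith, by push_cast; linarith⟩
      have : Int.fract y = y - n - 1 := by rw [Int.fract, hf]; push_cast; ring
      rw [this, hf, s0 _ (by linarith), s1 _ (by linarith)]; push_cast; ring
  have hev : ∀ y : ℝ, (fun y : ℝ => (⌊y⌋ : ℝ) + s (Int.fract y)) =ᶠ[𝓝 y]
      fun z => ⌊y⌋ + s (z - ⌊y⌋) := fun y => by
    refine eventually_of_mem (Ioo_mem_nhds ?_ ?_) (hloc ⌊y⌋)
    · linarith [Int.floor_le y]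
    · linarith [Int.lt_floor_add_one y]
  have hder : ∀ y : ℝ, deriv (fun y : ℝ => (⌊y⌋ : ℝ) + s (Int.fract y)) y
      = deriv s (Int.fract y) := fun y => by
    rw [(hev y).deriv_eq, deriv_const_add, deriv_comp_sub_const, Int.fract]
  refine ⟨fun y => ⌊y⌋ + s (Int.fract y), contDiff_iff_contDiffAt.2 fun y => ?_, fun y => ?_, ?_,
    fun y hy => ?_⟩
  · refine ContDiffAt.congr_of_eventuallyEq ?_ (hev y)
    exact (contDiff_const.add (hsd.comp (contDiff_id.sub contDiff_const))).contDiffAt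
  · have e : (⌊y⌋ : ℝ) + s (Int.fract y) - y = s (Int.fract y) - Int.fract y := by
      rw [Int.fract]; ring
    rw [e, abs_le]
    have h1 : 0 ≤ s (Int.fract y) := Real.smoothTransition.nonneg _
    have h2 : s (Int.fract y) ≤ 1 := Real.smoothTransition.le_one _
    exact ⟨by linarith [Int.fract_lt_one y], by linarith [Int.fract_nonneg y]⟩
  · obtain ⟨C, hC⟩ := isCompact_Icc.exists_bound_of_continuousOn (s := Icc (0 : ℝ) 1)
      (hsd.continuous_deriv (by simp)).continuousOn
    exact ⟨C, fun y => by
      rw [hder]; exact hC _ ⟨Int.fract_nonneg y, (Int.fract_lt_one y).le⟩⟩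
  · rw [hder] at hy
    refine ⟨⌊y⌋, Int.fract y, hrS ⟨?_, ?_⟩, (Int.floor_add_fract y).symm⟩
    · by_contra! h
      have : s =ᶠ[𝓝 (Int.fract y)] fun _ => 0 :=
        eventually_of_mem (Iio_mem_nhds h) fun z hz => s0 z (le_of_lt hz)
      exact hy (by rw [this.deriv_eq, deriv_const])
    · by_contra! h
      have : s =ᶠ[𝓝 (Int.fract y)] fun _ => 1 :=
        eventually_of_mem (Ioi_mem_nhds h) fun z hz => s1 z (le_of_lt hz)
      exact hy (by rw [this.deriv_eq, deriv_const])

/-- A test function is close in `L²` to functions that vary only in the inclusions, which have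
small energy. -/
lemma exists_corrector_of_testFunction (hΩ : IsOpen Ω) {S : Set ℝ} (hS : IsOpen S)
    (hSne : S.Nonempty) (hSY : S ⊆ unitCell) {φ : ℝ → ℝ} (hφ : IsTestFunction Ω φ) {v : H10 Ω}
    (hv : toL2 Ω v =ᵐ[volume.restrict Ω] φ) :
    ∃ N ε₀ : ℝ, 0 < ε₀ ∧ ∀ ε, 0 < ε → ε < ε₀ → ∃ w : H10 Ω, ‖toL2 Ω (v - w)‖ ≤ N * ε ∧
      √(bilin Ω (coeff (ε ^ 2) ε S Ω) w w) ≤ N * ε := by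
  obtain ⟨χ, hχ, hχ1, ⟨C₂, hC₂⟩, hχS⟩ := exists_staircase hS hSne hSY
  obtain ⟨C₁, hC₁⟩ := hφ.deriv.hasCompactSupport.exists_bound_of_continuous
    hφ.deriv.contDiff.continuous
  have hC₁0 : 0 ≤ C₁ := (norm_nonneg _).trans (hC₁ 0)
  have hC₂0 : 0 ≤ C₂ := (abs_nonneg _).trans (hC₂ 0)
  obtain ⟨ρ, hρ, hρΩ⟩ := hφ.hasCompactSupport.isCompact.exists_cthickening_subset_open hΩ
    hφ.tsupport_subset
  -- The substitution moves points by at most ε < ρ, so every corrector is supported in this fixed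
  -- compact subset of `Ω`.
  set K := Metric.cthickening ρ (tsupport φ) with hKdef
  have hK : IsCompact K := hφ.hasCompactSupport.isCompact.cthickening
  refine ⟨max (C₁ * √(volume.real K)) (C₁ * C₂ * √(volume.real K)), ρ, hρ, fun ε hε hερ => ?_⟩
  set g : ℝ → ℝ := fun x => ε * χ (x / ε) with hg
  have hgx : ∀ x, |g x - x| ≤ ε := fun x => by
    have e : g x - x = ε * (χ (x / ε) - x / ε) := by rw [hg]; field_simp
    rw [e, abs_mul, abs_of_pos hε]
    exact mul_le_of_le_one_right hε.le (hχ1 _)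
  have hgd : ContDiff ℝ ∞ g := contDiff_const.mul (hχ.comp (contDiff_id.div_const _))
  have hφd : Differentiable ℝ φ := hφ.contDiff.differentiable (by simp)
  have hg' : ∀ x, HasDerivAt g (deriv χ (x / ε)) x := fun x => by
    have h1 : HasDerivAt χ (deriv χ (x / ε)) (x / ε) :=
      (hχ.differentiable (by simp) _).hasDerivAt
    have h2 : HasDerivAt (fun x : ℝ => x / ε) (1 / ε) x := (hasDerivAt_id x).div_const ε
    have := (h1.comp x h2).const_mul ε
    rwa [mul_one_div, mul_div_cancel₀ _ hε.ne'] at this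
  have hd : ∀ x, deriv (φ ∘ g) x = deriv φ (g x) * deriv χ (x / ε) := fun x =>
    ((hφd (g x)).hasDerivAt.comp x (hg' x)).deriv
  have hKmem : ∀ x, g x ∈ tsupport φ → x ∈ K := fun x hx =>
    Metric.mem_cthickening_of_dist_le x (g x) ρ _ hx (by
      rw [dist_comm, Real.dist_eq]; exact (hgx x).trans hερ.le)
  have hsupp : Function.support (φ ∘ g) ⊆ K := fun x hx => hKmem x (subset_tsupport _ hx)
  have htest : IsTestFunction Ω (φ ∘ g) :=
    ⟨hφ.contDiff.comp hgd, HasCompactSupport.of_support_subset_isCompact hK hsupp,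
      (closure_minimal hsupp hK.isClosed).trans hρΩ⟩
  obtain ⟨w, hw, hw'⟩ := htest.exists_H10
  have hlip : ∀ x y, |φ x - φ y| ≤ C₁ * |x - y| := fun x y =>
    Convex.norm_image_sub_le_of_norm_deriv_le (fun z _ => hφd z) (fun z _ => hC₁ z)
      convex_univ (mem_univ y) (mem_univ x)
  refine ⟨w, ?_, ?_⟩
  · have : ‖toL2 Ω (v - w)‖ ≤ (C₁ * ε) * √(volume.real K) := by
      rw [map_sub]
      have hae : ∀ᵐ x ∂volume.restrict Ω, (toL2 Ω v - toL2 Ω w : L2 Ω) x = φ x - φ (g x) := by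
        filter_upwards [Lp.coeFn_sub (toL2 Ω v) (toL2 Ω w), hv, hw] with x h1 h2 h3
        rw [h1, Pi.sub_apply, h2, h3, Function.comp_apply]
      refine norm_L2_le_of_support hK (by positivity) ?_ ?_
      · filter_upwards [hae] with x hx
        rw [hx]
        refine (hlip _ _).trans ?_
        gcongr
        rw [abs_sub_comm]
        exact hgx x
      · filter_upwards [hae] with x hx hxK
        rw [hx, image_eq_zero_of_notMem_tsupport fun h => hxK (hKmem x h),
          image_eq_zero_of_notMem_tsupport fun h =>
            hxK (Metric.self_subset_cthickening _ h), sub_zero]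
    refine this.trans ?_
    rw [mul_right_comm]
    gcongr
    exact le_max_left _ _
  -- Wherever the derivative is nonzero the point lies in an inclusion, so the coefficient may be
  -- replaced by ε² everywhere.
  · have hval : ∀ᵐ x ∂volume.restrict Ω,
        coeff (ε ^ 2) ε S Ω x * grad Ω w x * grad Ω w x = ε ^ 2 * (deriv (φ ∘ g) x) ^ 2 := by
      filter_upwards [hw'] with x hx
      rw [hx]
      by_cases h0 : deriv (φ ∘ g) x = 0
      · rw [h0]; ring
      · have hxΩ : x ∈ Ω := by
          by_contra h
          exact h0 (htest.deriv.eq_zero h)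
        obtain ⟨j, s, hs, hxs⟩ := hχS (x / ε) fun h => h0 (by rw [hd, h, mul_zero])
        have : x ∈ inclusions ε S Ω :=
          ⟨mem_iUnion.2 ⟨j, s, hs, by change ε * (j + s) = x; rw [← hxs]; field_simp⟩, hxΩ⟩
        rw [coeff, if_pos this]; ring
    have hle : bilin Ω (coeff (ε ^ 2) ε S Ω) w w ≤ (ε * (C₁ * C₂)) ^ 2 * volume.real K := by
      rw [bilin]
      refine setIntegral_le_of_support hK ?_ ?_ ?_ (sq_nonneg _)
      · filter_upwards [hval] with x hx
        rw [hx]; positivity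
      · filter_upwards [hval] with x hx _
        rw [hx, mul_pow, hd]
        refine mul_le_mul_of_nonneg_left ?_ (sq_nonneg ε)
        rw [← sq_abs, abs_mul]
        gcongr
        · exact hC₁ _
        · exact hC₂ _
      · filter_upwards [hval] with x hx hxK
        rw [hx, hd, image_eq_zero_of_notMem_tsupport (f := deriv φ) fun h => hxK (hKmem x
          (closure_minimal support_deriv_subset (isClosed_tsupport _) h))]
        ring
    refine (Real.sqrt_le_sqrt hle).trans ?_
    rw [Real.sqrt_mul (sq_nonneg _), Real.sqrt_sq (by positivity)]
    calc _ = C₁ * C₂ * √(volume.real K) * ε := by ring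
      _ ≤ _ := by gcongr; exact le_max_right _ _

/-- Every element of `H^1_0` is a limit in `L²` of functions of vanishing energy. -/
lemma eventually_exists_corrector (hΩ : IsOpen Ω) {S : Set ℝ} (hS : IsOpen S)
    (hSne : S.Nonempty) (hSY : S ⊆ unitCell) (v : H10 Ω) {δ : ℝ} (hδ : 0 < δ) :
    ∀ᶠ ε in 𝓝[>] (0 : ℝ), ∃ w : H10 Ω, ‖toL2 Ω (v - w)‖ ≤ δ ∧
      √(bilin Ω (coeff (ε ^ 2) ε S Ω) w w) ≤ δ := by
  obtain ⟨φ, v', hφ, hv', hvv'⟩ := exists_testFunction_near v (half_pos hδ)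
  obtain ⟨N, ε₀, hε₀, h⟩ := exists_corrector_of_testFunction hΩ hS hSne hSY hφ hv'
  have hlim : Tendsto (fun ε : ℝ => N * ε) (𝓝[>] 0) (𝓝 0) := by
    have : Tendsto (fun ε : ℝ => N * ε) (𝓝 0) (𝓝 (N * 0)) := tendsto_id.const_mul N
    rw [mul_zero] at this
    exact this.mono_left nhdsWithin_le_nhds
  filter_upwards [hlim.eventually_lt_const (half_pos hδ), Ioo_mem_nhdsGT hε₀] with ε h1 h2
  obtain ⟨w, hw, hw'⟩ := h ε h2.1 h2.2
  refine ⟨w, ?_, by linarith⟩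
  have : v - w = (v - v') + (v' - w) := by abel
  rw [this, map_add]
  refine (norm_add_le _ _).trans ?_
  have := norm_toL2_le (v - v')
  linarith

end Form

/-! ### Two-scale convergence -/

section Oscillation

lemma periodic_eq_fract {f : ℝ → ℝ} (hf : Function.Periodic f 1) (y : ℝ) :
    f y = f (Int.fract y) := by
  have := hf.sub_int_mul_eq (x := y) ⌊y⌋
  rwa [mul_one, eq_comm] at this

/-- A continuous function `h(x,y)`, periodic in `y` and compactly supported in `x`, is uniformly
continuous in `x`. -/
lemma exists_uniform_shift {h : ℝ → ℝ → ℝ} (hc : Continuous (Function.uncurry h))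
    (hper : ∀ x, Function.Periodic (h x) 1) {K : Set ℝ} (hK : IsCompact K)
    (hsupp : ∀ x ∉ K, ∀ y, h x y = 0) {η : ℝ} (hη : 0 < η) :
    ∃ δ > 0, δ ≤ 1 ∧ ∀ r, |r| < δ → ∀ x y, |h (x + r) y - h x y| ≤ η := by
  set K' := Metric.cthickening 1 K
  have hA : IsCompact (K' ×ˢ Icc (0 : ℝ) 1) := hK.cthickening.prod isCompact_Icc
  obtain ⟨δ, hδ, hu⟩ := Metric.uniformContinuousOn_iff.1
    (hA.uniformContinuousOn_of_continuous hc.continuousOn) η hη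
  refine ⟨min δ 1, lt_min hδ one_pos, min_le_right _ _, fun r hr x y => ?_⟩
  have hr1 : |r| ≤ 1 := hr.le.trans (min_le_right _ _)
  by_cases hx : x ∈ K' ∧ x + r ∈ K'
  · rw [periodic_eq_fract (hper (x + r)), periodic_eq_fract (hper x)]
    have hy : Int.fract y ∈ Icc (0 : ℝ) 1 := ⟨Int.fract_nonneg y, (Int.fract_lt_one y).le⟩
    have := hu (x + r, Int.fract y) ⟨hx.2, hy⟩ (x, Int.fract y) ⟨hx.1, hy⟩ (by
      rw [Prod.dist_eq, dist_self, max_eq_left dist_nonneg, Real.dist_eq, add_sub_cancel_left]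
      exact hr.trans_le (min_le_left _ _))
    exact this.le
  -- If one of x, x + r leaves the 1-thickening, neither lies in `K`, and both values vanish.
  · have h1 : x ∉ K := fun h => hx ⟨Metric.self_subset_cthickening _ h,
      Metric.mem_cthickening_of_dist_le _ x _ _ h (by simpa [Real.dist_eq] using hr1)⟩
    have h2 : x + r ∉ K := fun h => hx ⟨Metric.mem_cthickening_of_dist_le _ (x + r) _ _ h
      (by simpa [Real.dist_eq] using hr1), Metric.self_subset_cthickening _ h⟩
    rw [hsupp _ h1, hsupp _ h2, sub_zero, abs_zero]
    exact hη.le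

/-- The mean value property of periodically oscillating functions. -/
lemma tendsto_integral_oscillating {h : ℝ → ℝ → ℝ} (hc : Continuous (Function.uncurry h))
    (hper : ∀ x, Function.Periodic (h x) 1) {K : Set ℝ} (hK : IsCompact K)
    (hsupp : ∀ x ∉ K, ∀ y, h x y = 0) :
    Tendsto (fun ε : ℝ => ∫ x, h x (x / ε)) (𝓝[>] 0) (𝓝 (∫ x, ∫ y in Ioo (0 : ℝ) 1, h x y)) := by
  set K' := Metric.cthickening 1 K
  have hK' : IsCompact K' := hK.cthickening
  have hKK' : K ⊆ K' := Metric.self_subset_cthickening K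
  have hsupp' : ∀ x ∉ K', ∀ y, h x y = 0 := fun x hx => hsupp x fun h => hx (hKK' h)
  -- Translating x by ε s leaves the left integral unchanged for each s; it is then averaged over s
  -- ∈ (0, 1]. Dropping the small shift in the first slot of `h` costs at most η pointwise, and by
  -- periodicity the average of h(x, x/ε + s) over s is exactly the cell mean.
  have main : ∀ η > 0, ∀ᶠ ε in 𝓝[>] (0 : ℝ),
      |(∫ x, h x (x / ε)) - ∫ x, ∫ y in Ioo (0 : ℝ) 1, h x y| ≤ η * volume.real K' := by
    intro η hη
    obtain ⟨δ, hδ, hδ1, hsh⟩ := exists_uniform_shift hc hper hK hsupp hη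
    filter_upwards [Ioo_mem_nhdsGT hδ] with ε hε
    have hε0 : ε ≠ 0 := hε.1.ne'
    have hcont : Continuous (Function.uncurry fun x s : ℝ => h x (x / ε + s)) :=
      hc.comp (f := fun p : ℝ × ℝ => (p.1, p.1 / ε + p.2)) (by fun_prop)
    have hint : Integrable (Function.uncurry fun x s : ℝ => h x (x / ε + s))
        ((volume.restrict K').prod (volume.restrict (Ioc (0 : ℝ) 1))) := by
      rw [Measure.prod_restrict]
      exact (hcont.continuousOn.integrableOn_compact (hK'.prod isCompact_Icc)).mono_set
        (prod_mono_right Ioc_subset_Icc_self)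
    have hB : ∫ x, ∫ y in Ioo (0 : ℝ) 1, h x y
        = ∫ s in Ioc (0 : ℝ) 1, ∫ x in K', h x (x / ε + s) := by
      rw [← integral_integral_swap hint,
        ← setIntegral_eq_integral_of_forall_compl_eq_zero (s := K') fun x hx => by
          simp [hsupp' x hx]]
      congr 1 with x
      have := (hper x).intervalIntegral_add_eq 0 (x / ε)
      have e := intervalIntegral.integral_comp_add_left (h x) (x / ε) (a := 0) (b := 1)
      rw [add_zero] at e
      rw [zero_add, ← e, intervalIntegral.integral_of_le zero_le_one,
        intervalIntegral.integral_of_le zero_le_one, integral_Ioc_eq_integral_Ioo] at this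
      exact this
    have hA : ∀ s, ∫ x, h x (x / ε) = ∫ x, h (x + ε * s) (x / ε + s) := fun s => by
      rw [← integral_add_right_eq_self (fun x => h x (x / ε)) (ε * s)]
      congr 1 with x
      rw [add_div, mul_div_cancel_left₀ _ hε0]
    have hBs : IntegrableOn (fun s => ∫ x in K', h x (x / ε + s)) (Ioc (0 : ℝ) 1) :=
      hint.integral_prod_right
    have hAc : ∫ x, h x (x / ε) = ∫ s in Ioc (0 : ℝ) 1, ∫ x, h x (x / ε) := by simp
    rw [hB, hAc, ← integral_sub (by simp) hBs]
    have hpt : ∀ s ∈ Ioc (0 : ℝ) 1,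
        ‖(∫ x, h x (x / ε)) - ∫ x in K', h x (x / ε + s)‖ ≤ η * volume.real K' := by
      intro s hs
      have hr : |ε * s| < δ := by
        rw [abs_of_nonneg (mul_nonneg hε.1.le hs.1.le)]
        nlinarith [hε.1, hε.2, hs.2]
      have hA' : ∫ x, h x (x / ε) = ∫ x in K', h (x + ε * s) (x / ε + s) := by
        rw [hA s, setIntegral_eq_integral_of_forall_compl_eq_zero]
        intro x hx
        refine hsupp _ (fun hx' => hx ?_) _
        refine Metric.mem_cthickening_of_dist_le x (x + ε * s) _ _ hx' ?_
        simpa [Real.dist_eq] using (hr.le.trans hδ1)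
      have c1 : Continuous fun x => h (x + ε * s) (x / ε + s) :=
        hc.comp (f := fun x : ℝ => (x + ε * s, x / ε + s)) (by fun_prop)
      have c2 : Continuous fun x => h x (x / ε + s) :=
        hc.comp (f := fun x : ℝ => (x, x / ε + s)) (by fun_prop)
      rw [hA', ← integral_sub (c1.continuousOn.integrableOn_compact hK')
        (c2.continuousOn.integrableOn_compact hK')]
      exact norm_setIntegral_le_of_norm_le_const hK'.measure_lt_top fun x _ => hsh _ hr x _
    have := norm_setIntegral_le_of_norm_le_const (μ := volume) (s := Ioc (0 : ℝ) 1) (by simp) hpt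
    simpa using this
  rw [Metric.tendsto_nhds]
  intro η hη
  filter_upwards [main (η / (volume.real K' + 1)) (by positivity)] with ε hε
  rw [Real.dist_eq]
  refine hε.trans_lt ?_
  rw [div_mul_eq_mul_div, div_lt_iff₀ (by positivity)]
  nlinarith

end Oscillation

/-! ### Pairing curves in L² with oscillating test functions -/

section TwoScale

variable {T : ℝ} {Ω : Set ℝ} {ψ : ℝ × ℝ × ℝ → ℝ}

namespace IsTwoScaleTest

lemma exists_compact (hψ : IsTwoScaleTest T Ω ψ) :
    ∃ K, IsCompact K ∧ K ⊆ Ω ∧ ∀ t, ∀ x ∉ K, ∀ y, ψ (t, x, y) = 0 := by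
  obtain ⟨K, hK, hKs, h0⟩ := hψ.support
  refine ⟨Prod.snd '' K, hK.image continuous_snd, ?_, fun t x hx y =>
    h0 t x y fun h => hx ⟨_, h, rfl⟩⟩
  rintro _ ⟨p, hp, rfl⟩
  exact (hKs hp).2

lemma exists_bound (hψ : IsTwoScaleTest T Ω ψ) : ∃ C, 0 ≤ C ∧ ∀ p, |ψ p| ≤ C := by
  obtain ⟨K, hK, -, h0⟩ := hψ.support
  obtain ⟨C, hC⟩ := (hK.prod (isCompact_Icc (a := (0 : ℝ)) (b := 1))).exists_bound_of_continuousOn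
    (f := fun q : (ℝ × ℝ) × ℝ => ψ (q.1.1, q.1.2, q.2))
    (hψ.contDiff.continuous.comp (by fun_prop)).continuousOn
  refine ⟨max C 0, le_max_right _ _, fun ⟨t, x, y⟩ => ?_⟩
  by_cases h : (t, x) ∈ K
  · rw [periodic_eq_fract (f := fun y => ψ (t, x, y)) (hψ.periodic t x) y]
    exact (hC ((t, x), Int.fract y) ⟨h, Int.fract_nonneg y, (Int.fract_lt_one y).le⟩).trans
      (le_max_left _ _)
  · rw [h0 t x y h, abs_zero]
    exact le_max_right _ _

/-- The sections `ψ(t, ·, ·/ε)` form a continuous curve in `L²(Ω)`. -/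
lemma exists_section (hψ : IsTwoScaleTest T Ω ψ) :
    ∃ M, 0 ≤ M ∧ ∀ ε : ℝ, ∃ Θ : ℝ → L2 Ω, Continuous Θ ∧ (∀ t, ‖Θ t‖ ≤ M) ∧
      ∀ t, Θ t =ᵐ[volume.restrict Ω] fun x => ψ (t, x, x / ε) := by
  obtain ⟨K, hK, -, hK0⟩ := hψ.exists_compact
  obtain ⟨C, hC0, hC⟩ := hψ.exists_bound
  -- The bound is uniform in ε and t, as the later density and domination arguments require.
  refine ⟨C * √(volume.real K), by positivity, fun ε => ?_⟩
  have hc : Continuous fun p : ℝ × ℝ => ψ (p.1, p.2, p.2 / ε) :=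
    hψ.contDiff.continuous.comp (by fun_prop)
  have hmem : ∀ t, MemLp (fun x => ψ (t, x, x / ε)) 2 (volume.restrict Ω) := fun t =>
    ((hc.comp (f := fun x : ℝ => (t, x)) (by fun_prop)).memLp_of_hasCompactSupport
      (HasCompactSupport.intro hK fun x hx => hK0 t x hx _)).restrict Ω
  refine ⟨fun t => (hmem t).toLp, ?_, fun t => ?_, fun t => (hmem t).coeFn_toLp⟩
  · have hcs : HasCompactSupport fun p : ℝ × ℝ => ψ (p.1, p.2, p.2 / ε) := by
      obtain ⟨K₂, hK₂, -, h0⟩ := hψ.support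
      exact HasCompactSupport.intro hK₂ fun p hp => h0 _ _ _ hp
    have huc := Metric.uniformContinuous_iff.1 (hcs.uniformContinuous_of_continuous hc)
    refine Metric.continuous_iff.2 fun t η hη => ?_
    set c := η / (√(volume.real K) + 1) with hcdef
    have hcpos : 0 < c := by positivity
    obtain ⟨δ, hδ, h⟩ := huc c hcpos
    refine ⟨δ, hδ, fun s hs => ?_⟩
    have hae : ∀ᵐ x ∂volume.restrict Ω, ((hmem s).toLp - (hmem t).toLp : L2 Ω) x
        = ψ (s, x, x / ε) - ψ (t, x, x / ε) := by
      filter_upwards [Lp.coeFn_sub (hmem s).toLp (hmem t).toLp, (hmem s).coeFn_toLp,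
        (hmem t).coeFn_toLp] with x h1 h2 h3
      rw [h1, Pi.sub_apply, h2, h3]
    rw [dist_eq_norm]
    refine (norm_L2_le_of_support hK hcpos.le ?_ ?_).trans_lt ?_
    · filter_upwards [hae] with x hx
      rw [hx]
      refine (h (a := (s, x)) (b := (t, x)) ?_).le
      rw [Prod.dist_eq, dist_self, max_eq_left dist_nonneg]
      exact hs
    · filter_upwards [hae] with x hx hxK
      rw [hx, hK0 _ _ hxK, hK0 _ _ hxK, sub_zero]
    · rw [hcdef, div_mul_eq_mul_div, div_lt_iff₀ (by positivity)]
      nlinarith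
  · refine norm_L2_le_of_support hK hC0 ?_ ?_
    · filter_upwards [(hmem t).coeFn_toLp] with x hx
      rw [hx]; exact hC _
    · filter_upwards [(hmem t).coeFn_toLp] with x hx hxK
      rw [hx, hK0 _ _ hxK]

/-- The section `ψ(t, ·, ·)` belongs to `L²(Ω × Y)`. -/
lemma exists_cellSection (hψ : IsTwoScaleTest T Ω ψ) (t : ℝ) :
    ∃ Ψ : L2Cell Ω, Ψ =ᵐ[cellMeasure Ω] fun p => ψ (t, p.1, p.2) := by
  obtain ⟨K, hK, -, hK0⟩ := hψ.exists_compact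
  obtain ⟨C, hC0, hC⟩ := hψ.exists_bound
  have hc : Continuous fun p : ℝ × ℝ => ψ (t, p.1, p.2) :=
    hψ.contDiff.continuous.comp (by fun_prop)
  have hfin : cellMeasure Ω (K ×ˢ univ) ≠ ⊤ := by
    rw [Measure.prod_prod, measure_univ, mul_one]
    exact ((Measure.restrict_apply_le _ _).trans_lt hK.measure_lt_top).ne
  have h1 : MemLp ((K ×ˢ univ : Set (ℝ × ℝ)).indicator fun _ => C) 2 (cellMeasure Ω) :=
    memLp_indicator_const 2 (hK.measurableSet.prod MeasurableSet.univ) C (Or.inr hfin)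
  have h2 : MemLp (fun p : ℝ × ℝ => ψ (t, p.1, p.2)) 2 (cellMeasure Ω) :=
    h1.of_le hc.aestronglyMeasurable (Eventually.of_forall fun p => by
      by_cases hp : p.1 ∈ K
      · have hp' : p ∈ (K ×ˢ univ : Set (ℝ × ℝ)) := ⟨hp, mem_univ _⟩
        rw [indicator_of_mem hp', Real.norm_of_nonneg hC0]
        exact hC _
      · rw [hK0 t p.1 hp, norm_zero]
        exact norm_nonneg _)
  exact ⟨h2.toLp, h2.coeFn_toLp⟩

end IsTwoScaleTest

lemma constInCell_ae_eq {g : L2 Ω} {f : ℝ → ℝ} (h : g =ᵐ[volume.restrict Ω] f) :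
    constInCell g =ᵐ[cellMeasure Ω] fun p => f p.1 :=
  (Lp.coeFn_compMeasurePreserving g measurePreserving_fst).trans
    (measurePreserving_fst.quasiMeasurePreserving.ae_eq h)

/-- Elements of `H^1_0`, tested with oscillating functions. -/
lemma IsTwoScaleTest.tendsto_H10 (hψ : IsTwoScaleTest T Ω ψ) (t : ℝ) (v : H10 Ω) :
    Tendsto (fun ε : ℝ => ∫ x in Ω, toL2 Ω v x * ψ (t, x, x / ε)) (𝓝[>] 0)
      (𝓝 (∫ p, constInCell (toL2 Ω v) p * ψ (t, p.1, p.2) ∂cellMeasure Ω)) := by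
  obtain ⟨M, hM, hΘ⟩ := hψ.exists_section
  choose Θ hΘc hΘM hΘae using hΘ
  obtain ⟨Ψ, hΨ⟩ := hψ.exists_cellSection t
  have e1 : ∀ (g : L2 Ω) (ε : ℝ), ∫ x in Ω, g x * ψ (t, x, x / ε) = inner ℝ (Θ ε t) g := by
    intro g ε
    rw [L2.inner_def]
    refine integral_congr_ae ?_
    filter_upwards [hΘae ε t] with x hx
    rw [hx]
    simp
  have e2 : ∀ g : L2 Ω, ∫ p, constInCell g p * ψ (t, p.1, p.2) ∂cellMeasure Ω
      = inner ℝ Ψ (constInCell g) := by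
    intro g
    rw [L2.inner_def]
    refine integral_congr_ae ?_
    filter_upwards [hΨ] with x hx
    rw [hx]
    simp
  -- For a test function the product φψ is continuous and the mean value property applies directly.
  -- General elements follow by density, since the pairings are bounded by `M` uniformly in ε.
  have htest : ∀ (φ : ℝ → ℝ) (w : H10 Ω), IsTestFunction Ω φ → toL2 Ω w =ᵐ[volume.restrict Ω] φ →
      Tendsto (fun ε : ℝ => inner ℝ (Θ ε t) (toL2 Ω w)) (𝓝[>] 0)
        (𝓝 (inner ℝ Ψ (constInCell (toL2 Ω w)))) := by
    intro φ w hφ hw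
    have := tendsto_integral_oscillating (h := fun x y => φ x * ψ (t, x, y))
      ((hφ.contDiff.continuous.comp continuous_fst).mul
        (hψ.contDiff.continuous.comp (f := fun p : ℝ × ℝ => (t, p.1, p.2)) (by fun_prop)))
      (fun x y => by change φ x * ψ (t, x, y + 1) = _; rw [hψ.periodic])
      hφ.hasCompactSupport.isCompact (fun x hx y => by
        rw [image_eq_zero_of_notMem_tsupport hx, zero_mul])
    refine (this.congr fun ε => ?_).trans_eq ?_
    · rw [← e1, ← setIntegral_eq_integral_of_forall_compl_eq_zero (s := Ω) fun x hx => by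
        rw [hφ.eq_zero hx, zero_mul]]
      refine integral_congr_ae ?_
      filter_upwards [hw] with x hx
      rw [hx]
    · congr 1
      have hae : ∀ᵐ p ∂cellMeasure Ω, constInCell (toL2 Ω w) p * ψ (t, p.1, p.2)
          = φ p.1 * ψ (t, p.1, p.2) := by
        filter_upwards [constInCell_ae_eq hw] with p hp
        rw [hp]
      have hint : Integrable (fun p : ℝ × ℝ => φ p.1 * ψ (t, p.1, p.2)) (cellMeasure Ω) := by
        refine Integrable.congr ?_ hae
        refine ((Lp.memLp (constInCell (toL2 Ω w))).integrable_mul (Lp.memLp Ψ)).congr ?_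
        filter_upwards [hΨ] with p hp
        rw [Pi.mul_apply, hp]
      rw [← e2, integral_congr_ae hae, integral_prod _ hint,
        setIntegral_eq_integral_of_forall_compl_eq_zero fun x hx => by
          simp [hφ.eq_zero hx]]
  simp only [e1, e2]
  rw [Metric.tendsto_nhds]
  intro η hη
  set c := η / (3 * (M + ‖Ψ‖ + 1)) with hc
  have hc0 : 0 < c := by positivity
  have hcη : c * (3 * (M + ‖Ψ‖ + 1)) = η := div_mul_cancel₀ _ (by positivity)
  obtain ⟨φ, w, hφ, hw, hvw⟩ := exists_testFunction_near v hc0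
  filter_upwards [Metric.tendsto_nhds.1 (htest φ w hφ hw) (η / 3) (by positivity)] with ε hε
  rw [Real.dist_eq] at hε ⊢
  have hvw' : ‖toL2 Ω v - toL2 Ω w‖ ≤ c := by
    rw [← map_sub]; exact (norm_toL2_le _).trans hvw.le
  have b1 : |inner ℝ (Θ ε t) (toL2 Ω v) - inner ℝ (Θ ε t) (toL2 Ω w)| ≤ M * c := by
    rw [← inner_sub_right]
    exact (abs_real_inner_le_norm _ _).trans (mul_le_mul (hΘM ε t) hvw' (norm_nonneg _) hM)
  have b2 : |inner ℝ Ψ (constInCell (toL2 Ω w)) - inner ℝ Ψ (constInCell (toL2 Ω v))|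
      ≤ ‖Ψ‖ * c := by
    rw [← inner_sub_right, constInCell, constInCell, ← map_sub]
    refine (abs_real_inner_le_norm _ _).trans ?_
    rw [Lp.norm_compMeasurePreserving]
    gcongr
    rw [norm_sub_rev]; exact hvw'
  have t1 := abs_sub_le (inner ℝ (Θ ε t) (toL2 Ω v)) (inner ℝ (Θ ε t) (toL2 Ω w))
    (inner ℝ Ψ (constInCell (toL2 Ω v)))
  have t2 := abs_sub_le (inner ℝ (Θ ε t) (toL2 Ω w)) (inner ℝ Ψ (constInCell (toL2 Ω w)))
    (inner ℝ Ψ (constInCell (toL2 Ω v)))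
  have : M * c + ‖Ψ‖ * c < η * (2 / 3) := by nlinarith
  linarith

/-- Strong convergence to a curve in `H^1_0` implies convergence against oscillating test
functions. -/
lemma IsTwoScaleTest.tendsto_of_strong (hψ : IsTwoScaleTest T Ω ψ) {W : ℝ → ℝ → L2 Ω}
    {U : ℝ → H10 Ω} {C : ℝ}
    (hm : ∀ᶠ ε in 𝓝[>] (0 : ℝ), AEStronglyMeasurable (W ε) (timeMeasure T))
    (hb : ∀ᶠ ε in 𝓝[>] (0 : ℝ), ∀ t ∈ Ioo 0 T, ‖W ε t‖ ≤ C)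
    (hW : ∀ t ∈ Ioo 0 T, Tendsto (fun ε : ℝ => W ε t - toL2 Ω (U t)) (𝓝[>] 0) (𝓝 0)) :
    Tendsto (fun ε : ℝ => ∫ t in Ioo 0 T, ∫ x in Ω, W ε t x * ψ (t, x, x / ε)) (𝓝[>] 0)
      (𝓝 (∫ t in Ioo 0 T, ∫ p, constInCell (toL2 Ω (U t)) p * ψ (t, p.1, p.2) ∂cellMeasure Ω)) := by
  obtain ⟨M, hM, hΘ⟩ := hψ.exists_section
  choose Θ hΘc hΘM hΘae using hΘ
  have e1 : ∀ (g : L2 Ω) (ε t : ℝ), ∫ x in Ω, g x * ψ (t, x, x / ε) = inner ℝ (Θ ε t) g := by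
    intro g ε t
    rw [L2.inner_def]
    refine integral_congr_ae ?_
    filter_upwards [hΘae ε t] with x hx
    rw [hx]
    simp
  simp only [e1]
  refine tendsto_integral_filter_of_dominated_convergence (fun _ => M * C) ?_ ?_
    (integrable_const _) ?_
  · filter_upwards [hm] with ε hε
    exact (hΘc ε).aestronglyMeasurable.inner hε
  · filter_upwards [hb] with ε hε
    rw [ae_restrict_iff' measurableSet_Ioo]
    refine Eventually.of_forall fun t ht => ?_
    rw [Real.norm_eq_abs]
    exact (abs_real_inner_le_norm _ _).trans
      (mul_le_mul (hΘM ε t) (hε t ht) (norm_nonneg _) hM)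
  · rw [ae_restrict_iff' measurableSet_Ioo]
    refine Eventually.of_forall fun t ht => ?_
    have h1 := hψ.tendsto_H10 t (U t)
    simp only [e1] at h1
    have h2 : Tendsto (fun ε => inner ℝ (Θ ε t) (W ε t - toL2 Ω (U t))) (𝓝[>] 0) (𝓝 0) := by
      refine squeeze_zero_norm (a := fun ε => M * ‖W ε t - toL2 Ω (U t)‖) (fun ε => ?_) ?_
      · exact (abs_real_inner_le_norm _ _).trans (by gcongr; exact hΘM ε t)
      · simpa using (hW t ht).norm.const_mul M
    have h3 := h2.add h1
    rw [zero_add] at h3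
    refine h3.congr fun ε => ?_
    rw [inner_sub_right, sub_add_cancel]

end TwoScale

/-! ### The limit of the wave equations -/

section Limit

variable {T : ℝ} {Ω : Set ℝ}

lemma restrict_Ioc_eq_timeMeasure (T : ℝ) : volume.restrict (Ioc 0 T) = timeMeasure T :=
  (restrict_Ioo_eq_restrict_Ioc).symm

lemma MemBochnerL2.integrableOn {X : Type*} [NormedAddCommGroup X] {u : ℝ → X}
    (h : MemBochnerL2 T u) : IntegrableOn u (Ioo 0 T) :=
  MemLp.integrable one_le_two h

/-- `toHNeg1` is a bare function; writing it as a continuous linear map transfers integrability. -/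
lemma integrableOn_toHNeg1 {s : Set ℝ} {g : ℝ → L2 Ω} (hg : IntegrableOn g s) :
    IntegrableOn (fun t => toHNeg1 (g t)) s :=
  (((ContinuousLinearMap.compL ℝ (H10 Ω) (L2 Ω) ℝ).flip (toL2 Ω)).comp
    (innerSL ℝ (E := L2 Ω) : L2 Ω →L[ℝ] L2 Ω →L[ℝ] ℝ)).integrable_comp hg

/-- A weak solution satisfies the wave equation integrated in time. -/
lemma IsWeakSolution.exists_integratedWave (hT : 0 < T) {a : ℝ → ℝ} {u₀ v₀ : H10 Ω}
    {u : ℝ → H10 Ω} (hu : IsWeakSolution T Ω a (fun _ => 0) u₀ (toL2 Ω v₀) u)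
    {b : H10 Ω →L[ℝ] H10 Ω →L[ℝ] ℝ} (hb : ∀ v w, b v w = bilin Ω a v w)
    (hsymm : ∀ v w, b v w = b w v) (hpos : ∀ v, 0 ≤ b v v) (hle : ∀ v, b v v ≤ ‖v‖ ^ 2) :
    ∃ d, IntegratedWave T (toL2 Ω) b u₀ v₀ u d := by
  obtain ⟨hu2, u', u'', hu', hu'', hd, hdd, heq, hi, hi'⟩ := hu
  have ioc : ∀ {X : Type} [NormedAddCommGroup X] {w : ℝ → X}, IntegrableOn w (Ioo 0 T) →
      IntegrableOn w (Ioc 0 T) := fun hw => (integrableOn_Ioc_iff_integrableOn_Ioo (by simp)).2 hw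
  have hu'i := ioc hu'.integrableOn
  have hu''i := ioc hu''.integrableOn
  have hui := ioc hu2.integrableOn
  refine ⟨fun t => u' t - toL2 Ω v₀, hT, hsymm, hpos, hle, hui, hu'i.sub (by simp), ?_, ?_⟩
  · have := hd.ae_eq_primitive hT ((toL2 Ω).integrable_comp hu2.integrableOn) hu'.integrableOn hi
    rw [restrict_Ioc_eq_timeMeasure]
    filter_upwards [this, ae_restrict_mem measurableSet_Ioo] with t ht htT
    have hint : IntervalIntegrable u' volume 0 t :=
      (intervalIntegrable_iff_integrableOn_Ioc_of_le htT.1.le).2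
        (hu'i.mono_set (Ioc_subset_Ioc_right htT.2.le))
    rw [ht, intervalIntegral.integral_sub hint (by simp), intervalIntegral.integral_const, sub_zero,
      map_add, map_smul]
    abel
  · have := hdd.ae_eq_primitive hT (integrableOn_toHNeg1 hu'.integrableOn) hu''.integrableOn hi'
    rw [restrict_Ioc_eq_timeMeasure]
    -- The identity `ht` holds in the dual space, so the exceptional times do not depend on `v`. The
    -- null sets of `heq v` do, but they disappear under the integral over s.
    filter_upwards [this, ae_restrict_mem measurableSet_Ioo] with t ht htT v
    have hsub : Ioc 0 t ⊆ Ioc 0 T := Ioc_subset_Ioc_right htT.2.le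
    have e1 : inner ℝ (u' t) (toL2 Ω v)
        = inner ℝ (toL2 Ω v₀) (toL2 Ω v) + (∫ s in (0)..t, u'' s) v :=
      congrArg (fun F : HNeg1 Ω => F v) ht
    have e2 : (∫ s in (0)..t, u'' s) v = -b (∫ s in (0)..t, u s) v := by
      rw [intervalIntegral.integral_of_le htT.1.le, intervalIntegral.integral_of_le htT.1.le,
        ContinuousLinearMap.integral_apply (hu''i.mono_set hsub)]
      change _ = -b.flip v _
      rw [← ContinuousLinearMap.integral_comp_comm _ (hui.mono_set hsub), ← integral_neg]
      refine integral_congr_ae ?_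
      refine ae_restrict_of_ae_restrict_of_subset hsub ?_
      rw [restrict_Ioc_eq_timeMeasure]
      filter_upwards [heq v] with s hs
      rw [inner_zero_left] at hs
      change u'' s v = -b (u s) v
      rw [hb]
      linarith
    rw [inner_sub_left, e1, e2]
    ring

/-- Weak solutions of the high-contrast problems differ from `u₀ + t v₀` by a term which is bounded,
and small if the data have correctors. -/
lemma IsWeakSolution.exists_remainder (hT : 0 < T) (hΩ : IsOpen Ω) {S : Set ℝ} (hS : IsOpen S)
    {ε : ℝ} (hε : 0 < ε) (hε1 : ε ≤ 1) {u₀ v₀ : H10 Ω} {u : ℝ → H10 Ω}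
    (hu : IsWeakSolution T Ω (coeff (ε ^ 2) ε S Ω) (fun _ => 0) u₀ (toL2 Ω v₀) u) :
    ∃ z : ℝ → L2 Ω, ContinuousOn z (Icc 0 T) ∧
      (∀ᵐ t ∂timeMeasure T, toL2 Ω (u t) = toL2 Ω (u₀ + t • v₀) + z t) ∧
      (∀ t ∈ Icc 0 T, ‖z t‖ ≤ IntegratedWave.bound T u₀ v₀) ∧
      ∀ δ : ℝ, 0 ≤ δ →
        (∃ w, ‖toL2 Ω (u₀ - w)‖ ≤ δ ∧ √(bilin Ω (coeff (ε ^ 2) ε S Ω) w w) ≤ δ) →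
        (∃ w, ‖toL2 Ω (v₀ - w)‖ ≤ δ ∧ √(bilin Ω (coeff (ε ^ 2) ε S Ω) w w) ≤ δ) →
        ∀ t ∈ Icc 0 T,
          ‖z t‖ ^ 2 ≤ 2 * (1 + 2 * T) * (1 + T) * IntegratedWave.bound T u₀ v₀ * δ := by
  obtain ⟨b, hb, hsymm, hpos, hle⟩ := exists_continuous_bilin (Ω := Ω)
    (measurable_coeff (a₀ := ε ^ 2) hε.ne' hΩ hS)
    (fun x => by unfold coeff; split_ifs <;> positivity)
    (fun x => by unfold coeff; split_ifs <;> nlinarith)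
  obtain ⟨d, hd⟩ := hu.exists_integratedWave hT hb hsymm hpos hle
  obtain ⟨h1, h2⟩ := hd.norm_primitive_le
  refine ⟨fun t => ∫ s in (0)..t, d s, continuousOn_primitive_Icc hT.le hd.integrable_deriv, ?_,
    h1, ?_⟩
  · rw [← restrict_Ioc_eq_timeMeasure]
    exact hd.eq_primitive
  · rintro δ hδ ⟨w, hw, hw'⟩ ⟨w₁, hw₁, hw₁'⟩
    rw [← hb] at hw' hw₁'
    exact h2 δ hδ w w₁ hw hw' hw₁ hw₁'

lemma continuous_affine_curve (u₀ v₀ : H10 Ω) : Continuous fun t : ℝ => u₀ + t • v₀ := by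
  fun_prop

lemma memBochnerL2_of_continuous {X : Type*} [NormedAddCommGroup X] {f : ℝ → X}
    (hf : Continuous f) : MemBochnerL2 T f := by
  obtain ⟨C, hC⟩ := (isCompact_Icc (a := (0 : ℝ)) (b := T)).exists_bound_of_continuousOn
    hf.continuousOn
  refine MemLp.of_bound hf.aestronglyMeasurable C ?_
  filter_upwards [ae_restrict_mem measurableSet_Ioo] with t ht
  exact hC t (Ioo_subset_Icc_self ht)

lemma hasWeakTimeDeriv_affine {X : Type*} [NormedAddCommGroup X] [NormedSpace ℝ X]
    [CompleteSpace X] (hT : 0 < T) (x y : X) :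
    HasWeakTimeDeriv T (fun t => x + t • y) (fun _ => y) := by
  intro φ hφ
  have hc : IntegrableOn (fun t : ℝ => x + t • y) (Ioo 0 T) :=
    (memBochnerL2_of_continuous (by fun_prop)).integrableOn
  have hφT : φ T = 0 := hφ.eq_zero (by simp)
  have h1 : ∫ t in Ioo 0 T, deriv φ t = 0 := by
    rw [← integral_Ioc_eq_integral_Ioo, ← intervalIntegral.integral_of_le hT.le,
      hφ.integral_deriv_eq, hφT]
  have h2 := (bilin_primitive (ContinuousLinearMap.lsmul ℝ ℝ (E := X)) hT.le (f := deriv φ)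
    (g := fun _ => y) hφ.deriv.integrable.integrableOn (by simp)).2.2
  simp only [hφ.integral_deriv_eq, hφT, map_zero, zero_apply, ContinuousLinearMap.lsmul_apply,
    intervalIntegral.integral_const, sub_zero, integral_Ioc_eq_integral_Ioo] at h2
  simp only [smul_add]
  rw [integral_add (hφ.deriv.integrableOn_smul (by simp))
    (hφ.deriv.integrableOn_smul ((memBochnerL2_of_continuous (by fun_prop)).integrableOn)),
    integral_smul_const, h1, zero_smul, zero_add]
  exact eq_neg_of_add_eq_zero_left h2.symm

lemma continuous_constInCell : Continuous (constInCell : L2 Ω → L2Cell Ω) :=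
  (Lp.isometry_compMeasurePreserving measurePreserving_fst).continuous

end Limit

end HighContrastWave

end

/-! ### The main theorem -/

open HighContrastWave
theorem proposition3p1 (T : ℝ) (hT : 0 < T)
    (Ω : Set ℝ) (hΩ : IsOpen Ω) (hΩc : IsConnected Ω)
    (S : Set ℝ) (hS : IsOpen S) (hSne : S.Nonempty) (hSY : S ⊂ unitCell)
    (u₀ v₀ : H10 Ω)
    (u : ℝ → ℝ → H10 Ω)
    (hu : ∀ ε : ℝ, 0 < ε → ε ≤ 1 →
      IsWeakSolution T Ω (coeff (ε ^ 2) ε S Ω) (fun _ => 0) u₀ (toL2 Ω v₀) (u ε)) :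
    ∃ uhat : ℝ → H10 Ω,
      MemBochnerL2 T uhat ∧
      (∃ uhat' : ℝ → L2 Ω, MemBochnerL2 T uhat' ∧
        HasWeakTimeDeriv T (fun t => toL2 Ω (uhat t)) uhat') ∧
      TwoScaleConverges T Ω (fun ε t => toL2 Ω (u ε t))
        (fun t => constInCell (toL2 Ω (uhat t))) ∧
      ∀ t ∈ Set.Icc 0 T, uhat t = u₀ + t • v₀ := by
  have hex : ∀ ε : ℝ, ∃ z : ℝ → L2 Ω, 0 < ε → ε ≤ 1 → _ := fun ε => by
    by_cases h : 0 < ε ∧ ε ≤ 1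
    · obtain ⟨z, hz⟩ := (hu ε h.1 h.2).exists_remainder hT hΩ hS h.1 h.2
      exact ⟨z, fun _ _ => hz⟩
    -- A default value for ε outside (0, 1], invisible to the limit ε → 0⁺.
    · exact ⟨0, fun h1 h2 => absurd ⟨h1, h2⟩ h⟩
  choose z hz using hex
  have hsmall : ∀ᶠ ε in 𝓝[>] (0 : ℝ), 0 < ε ∧ ε ≤ 1 := by
    filter_upwards [Ioc_mem_nhdsGT (one_pos (α := ℝ))] with ε hε using hε
  have hcurve := continuous_affine_curve u₀ v₀
  set B := IntegratedWave.bound T u₀ v₀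
  obtain ⟨C, hC⟩ := (isCompact_Icc (a := (0 : ℝ)) (b := T)).exists_bound_of_continuousOn
    ((toL2 Ω).continuous.comp hcurve).continuousOn
  have hWle : ∀ ε, 0 < ε → ε ≤ 1 → ∀ t ∈ Ioo 0 T,
      ‖toL2 Ω (u₀ + t • v₀) + z ε t‖ ≤ C + B := fun ε h1 h2 t ht =>
    (norm_add_le _ _).trans (add_le_add (hC t (Ioo_subset_Icc_self ht))
      ((hz ε h1 h2).2.2.1 t (Ioo_subset_Icc_self ht)))
  refine ⟨fun t => u₀ + t • v₀, memBochnerL2_of_continuous hcurve,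
    ⟨fun _ => toL2 Ω v₀, memBochnerL2_of_continuous continuous_const, ?_⟩,
    ⟨⟨((timeMeasure T univ) ^ ((2 : ℝ≥0∞).toReal)⁻¹ * ENNReal.ofReal (C + B)).toNNReal, ?_⟩,
      memBochnerL2_of_continuous
        (continuous_constInCell.comp ((toL2 Ω).continuous.comp hcurve)), fun ψ hψ => ?_⟩,
    fun _ _ => rfl⟩
  · simpa using hasWeakTimeDeriv_affine hT (toL2 Ω u₀) (toL2 Ω v₀)
  · filter_upwards [hsmall] with ε hε
    refine ⟨(toL2 Ω).comp_memLp' (hu ε hε.1 hε.2).1, ?_⟩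
    rw [ENNReal.coe_toNNReal (ENNReal.mul_ne_top
      (ENNReal.rpow_ne_top_of_nonneg (by simp) (measure_ne_top _ _)) ENNReal.ofReal_ne_top)]
    refine eLpNorm_le_of_ae_bound ?_
    filter_upwards [(hz ε hε.1 hε.2).2.1, ae_restrict_mem measurableSet_Ioo] with t ht htT
    rw [ht]
    exact hWle ε hε.1 hε.2 t htT
  -- The solution is replaced by its representative continuous in time, for which the bound and the
  -- convergence hold at every t rather than almost every t.
  · refine (hψ.tendsto_of_strong (W := fun ε t => toL2 Ω (u₀ + t • v₀) + z ε t)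
      (U := fun t => u₀ + t • v₀) (C := C + B) ?_ ?_ fun t ht => ?_).congr' ?_
    · filter_upwards [hsmall] with ε hε
      refine ((toL2 Ω).continuous.comp hcurve).aestronglyMeasurable.add ?_
      exact ((hz ε hε.1 hε.2).1.mono Ioo_subset_Icc_self).aestronglyMeasurable measurableSet_Ioo
    · filter_upwards [hsmall] with ε hε using hWle ε hε.1 hε.2
    · simp only [add_sub_cancel_left]
      rw [tendsto_zero_iff_norm_tendsto_zero]
      have hsq : Tendsto (fun ε => ‖z ε t‖ ^ 2) (𝓝[>] (0 : ℝ)) (𝓝 0) := by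
        have hD : 0 ≤ 2 * (1 + 2 * T) * (1 + T) * B := by
          have : 0 ≤ B := by simp only [B, IntegratedWave.bound]; positivity
          positivity
        set D := 2 * (1 + 2 * T) * (1 + T) * B
        rw [Metric.tendsto_nhds]
        intro η hη
        -- With this tolerance for the correctors the remainder estimate is D η / (D + 1) < η; the
        -- added 1 covers D = 0.
        have hδ : 0 < η / (D + 1) := by positivity
        filter_upwards [hsmall, eventually_exists_corrector hΩ hS hSne hSY.subset u₀ hδ,
          eventually_exists_corrector hΩ hS hSne hSY.subset v₀ hδ] with ε hε h1 h2
        have := (hz ε hε.1 hε.2).2.2.2 _ hδ.le h1 h2 t (Ioo_subset_Icc_self ht)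
        rw [Real.dist_eq, sub_zero, abs_of_nonneg (sq_nonneg _)]
        refine this.trans_lt ?_
        rw [mul_div_assoc', div_lt_iff₀ (by positivity)]
        nlinarith
      have := hsq.sqrt
      simpa [Real.sqrt_sq (norm_nonneg _)] using this
    · filter_upwards [hsmall] with ε hε
      refine integral_congr_ae ?_
      filter_upwards [(hz ε hε.1 hε.2).2.1] with t ht
      rw [ht]
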